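/- **Setting.** Let $n\ge 1$, $0<s<1$, $T>0$, let $\Omega\subset\mathbb R^n$ be a bounded open set, and let $Q\in L^\infty(\Omega_T)$ be real-valued, where $\Omega_T=(-T,T)\times\Omega$. Put $\Omega_e=\mathbb R^n\setminus\overline\Omega$ and $(\Omega_e)_T=(-T,T)\times\Omega_e$. Points of $\mathbb R^{n+1}=\mathbb R\times\mathbb R^n$ are written $(t,x)$, functions are complex-valued, and $\widehat u(\rho,\xi)$ is the unitary Fourier transform in $(t,x)$. For $b>0$, $\mathcal L^b=(\partial_t-\Delta)^b$ and $\mathcal L^b_*$ are the Fourier multipliers with symbols $(i\rho+|\xi|^2)^b$ and $(-i\rho+|\xi|^2)^b$ (principal branch). Let $$\mathcal H^s(\mathbb R^{n+1})=\Big\{u\in L^2(\mathbb R^{n+1}):\ \|u\|_{\mathcal H^s}^2=\int_{\mathbb R^{n+1}}(1+|i\rho+|\xi|^2|)^s|\widehat u|^2\,d\rho\,d\xi<\infty\Big\}.$$ For closed $E$ let $\mathcal H^s_E$ be the subspace of those $u\in\mathcal H^s(\mathbb R^{n+1})$ with $\operatorname{supp}u\subset E$, with the same norm. For open $O$ let $\mathcal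 H^s(O)$ be the space of restrictions $u|_O$ of $u\in\mathcal H^s(\mathbb R^{n+1})$, with norm $\|f\|_{\mathcal H^s(O)}=\inf\{\|g\|_{\mathcal H^s}:g|_O=f\}$. Let $(\mathcal H^s_{\overline{\Omega_T}})^*$ be the space of bounded conjugate-linear functionals on $\mathcal H^s_{\overline{\Omega_T}}$, with the dual norm. Write $(u,w)_O=\int_O u\overline w\,dx\,dt$, $u_T=\chi_{[-T,T]}(t)\,u$, and $$B_Q(u,w)=(\mathcal L^{s/2}u,\mathcal L^{s/2}_*w)_{\mathbb R^{n+1}}+(Qu,w)_{\Omega_T},\qquad u,w\in\mathcal H^s(\mathbb R^{n+1}).$$ Given $\lambda\in\mathbb R$, $F\in(\mathcal H^s_{\overline{\Omega_T}})^*$ and $f\in\mathcal H^s((\Omega_e)_T)$, a *weak solution* of the initial exterior value problem $$(\mathcal L^s+Q-\lambda)u=F\ \text{in }\Omega_T,\qquad u=f\ \text{in }(\Omega_e)_T,\qquad u=0\ \text{for }t\le -T \tag{P}$$ is a $u\in\mathcal H^s(\mathbb R^{n+1})$ that satisfies the last two conditions almost everywhere and $$B_Q(u,w)-\lambda(u,w)_{\Omega_T}=\langle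 F,w\rangle\quad\text{for all }w\in\mathcal H^s_{\overline{\Omega_T}}.\tag{E}$$ Say that (P) is *well-posed at $\lambda$* if there is a constant $C_0>0$ such that for all $F\in(\mathcal H^s_{\overline{\Omega_T}})^*$ and $f\in\mathcal H^s((\Omega_e)_T)$ there exists a unique $u_T\in\mathcal H^s(\mathbb R^{n+1})$, vanishing for $|t|>T$, with $(u_T-f)_T\in\mathcal H^s_{\overline{\Omega_T}}$ (for $f$ extended to some element of $\mathcal H^s(\mathbb R^{n+1})$) and with (E) for $u=u_T$; this $u_T$ is a weak solution of (P), every weak solution of (P) coincides with $u_T$ for $t\le T$, and $$\|u_T\|_{\mathcal H^s(\mathbb R^{n+1})}\le C_0\left(\|F\|_{(\mathcal H^s_{\overline{\Omega_T}})^*}+\|f\|_{\mathcal H^s((\Omega_e)_T)}\right).$$ Say that $Q$ satisfies the *eigenvalue condition* if every $u\in\mathcal H^s(\mathbb R^{n+1})$ with $u=0$ in $(\Omega_e)_T$, $u=0$ for $t\le -T$ and $B_Q(u,w)=0$ for all $w\in\mathcal H^s_{\overline{\Omega_T}}$ vanishes in $(-\infty,T)\times\mathbb R^n$. **Theorem (Well-posedness).**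 There is a countable set $\Sigma=\{\lambda_j\}_{j=1}^\infty$ of real numbers $\lambda_1\le\lambda_2\le\cdots\to+\infty$ such that: 1. for every $\lambda\in\mathbb R\setminus\Sigma$, (P) is well-posed at $\lambda$; 2. $Q$ satisfies the eigenvalue condition if and only if $0\notin\Sigma$; 3. if $Q\ge 0$ a.e. in $\Omega_T$, then $\Sigma\subset(0,\infty)$ and $Q$ satisfies the eigenvalue condition. Moreover, for every $\lambda\in\mathbb R$, (P) is well-posed at $\lambda$ if and only if $Q-\lambda$ satisfies the eigenvalue condition. -/

import Mathlib

open MeasureTheory Filter Set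
open scoped FourierTransform ENNReal ComplexConjugate Topology

noncomputable section

namespace FracHeat

/-- Space-time `ℝ × ℝⁿ` with its Euclidean structure and Lebesgue measure;
`z.fst` is the time `t` and `z.snd` is the position `x`. -/
abbrev SpaceTime (n : ℕ) : Type := WithLp 2 (ℝ × EuclideanSpace ℝ (Fin n))

/-- Complex-valued square integrable functions on space-time. -/
abbrev L2 (n : ℕ) : Type := Lp ℂ 2 (volume : Measure (SpaceTime n))

/-- The symbol `i ρ + |ξ|²` of `∂ₜ - Δ`. The Fourier transform `𝓕` has the kernel
`exp (-2πi ⟨z, ζ⟩)`, so the frequency is `(ρ, ξ) = 2π ζ`. -/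
def heatSymbol {n : ℕ} (ζ : SpaceTime n) : ℂ :=
  Complex.I * ((2 * Real.pi * ζ.fst : ℝ) : ℂ) + (((2 * Real.pi * ‖ζ.snd‖) ^ 2 : ℝ) : ℂ)

/-- The weight `(1 + |i ρ + |ξ|²|) ^ (a / 2)`. -/
def weight {n : ℕ} (a : ℝ) (ζ : SpaceTime n) : ℝ := (1 + ‖heatSymbol ζ‖) ^ (a / 2)

/-- The set of `u ∈ L²` with `∫ (1 + |i ρ + |ξ|²|) ^ a |û|² < ∞`, as a subspace of `L²`. -/
def HSub (n : ℕ) (a : ℝ) : Submodule ℂ (L2 n) where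
  carrier := {u | MemLp (fun ζ => (weight a ζ : ℂ) * (𝓕 u : L2 n) ζ) 2 volume}
  zero_mem' := by
    have h0 : (𝓕 (0 : L2 n) : L2 n) = 0 := (Lp.fourierTransformₗᵢ (SpaceTime n) ℂ).map_zero
    refine (memLp_congr_ae ?_).mpr (MemLp.zero' (ε := ℂ))
    rw [h0]
    filter_upwards [Lp.coeFn_zero ℂ 2 (volume : Measure (SpaceTime n))] with ζ hζ
    simp only [hζ, Pi.zero_apply, mul_zero]
  add_mem' := by
    intro u v hu hv
    have h : (𝓕 (u + v) : L2 n) = 𝓕 u + 𝓕 v :=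
      (Lp.fourierTransformₗᵢ (SpaceTime n) ℂ).map_add u v
    refine (memLp_congr_ae ?_).mpr (MemLp.add hu hv)
    rw [h]
    filter_upwards [Lp.coeFn_add (𝓕 u : L2 n) (𝓕 v)] with ζ hζ
    simp only [hζ, Pi.add_apply, mul_add]
  smul_mem' := by
    intro c u hu
    have h : (𝓕 (c • u) : L2 n) = c • 𝓕 u :=
      (Lp.fourierTransformₗᵢ (SpaceTime n) ℂ).map_smul c u
    refine (memLp_congr_ae ?_).mpr (MemLp.const_smul hu c)
    rw [h]
    filter_upwards [Lp.coeFn_smul c (𝓕 u : L2 n)] with ζ hζ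
    simp only [hζ, Pi.smul_apply, smul_eq_mul]
    ring

/-- The space `𝓗ᵃ(ℝⁿ⁺¹)`; it carries its own norm, not that of `L²`. -/
def HSpace (n : ℕ) (a : ℝ) : Type := ↥(HSub n a)

instance (n : ℕ) (a : ℝ) : AddCommGroup (HSpace n a) :=
  inferInstanceAs (AddCommGroup ↥(HSub n a))

instance (n : ℕ) (a : ℝ) : Module ℂ (HSpace n a) :=
  inferInstanceAs (Module ℂ ↥(HSub n a))

/-- The inclusion `𝓗ᵃ(ℝⁿ⁺¹) ⊆ L²(ℝⁿ⁺¹)`. -/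
def HSpace.incl (n : ℕ) (a : ℝ) : HSpace n a →ₗ[ℂ] L2 n := (HSub n a).subtype

instance (n : ℕ) (a : ℝ) : CoeOut (HSpace n a) (L2 n) := ⟨HSpace.incl n a⟩

theorem HSpace.memLp_weighted {n : ℕ} {a : ℝ} (u : HSpace n a) :
    MemLp (fun ζ => (weight a ζ : ℂ) * (𝓕 (u : L2 n) : L2 n) ζ) 2 volume :=
  Subtype.property u

/-- The map `u ↦ (1 + |i ρ + |ξ|²|) ^ (a / 2) û` into `L²`. -/
def HSpace.weighted (n : ℕ) (a : ℝ) : HSpace n a →ₗ[ℂ] L2 n where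
  toFun u := (HSpace.memLp_weighted u).toLp _
  map_add' u v := by
    rw [← MemLp.toLp_add, MemLp.toLp_eq_toLp_iff]
    have h : (𝓕 ((u + v : HSpace n a) : L2 n) : L2 n) = 𝓕 (u : L2 n) + 𝓕 (v : L2 n) := by
      rw [map_add]
      exact (Lp.fourierTransformₗᵢ (SpaceTime n) ℂ).map_add _ _
    rw [h]
    filter_upwards [Lp.coeFn_add (𝓕 (u : L2 n) : L2 n) (𝓕 (v : L2 n))] with ζ hζ
    simp only [hζ, Pi.add_apply, mul_add]
  map_smul' c u := by
    rw [RingHom.id_apply, ← MemLp.toLp_const_smul, MemLp.toLp_eq_toLp_iff]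
    have h : (𝓕 ((c • u : HSpace n a) : L2 n) : L2 n) = c • 𝓕 (u : L2 n) := by
      rw [map_smul]
      exact (Lp.fourierTransformₗᵢ (SpaceTime n) ℂ).map_smul _ _
    rw [h]
    filter_upwards [Lp.coeFn_smul c (𝓕 (u : L2 n) : L2 n)] with ζ hζ
    simp only [hζ, Pi.smul_apply, smul_eq_mul]
    ring

theorem weight_pos {n : ℕ} (a : ℝ) (ζ : SpaceTime n) : 0 < weight a ζ :=
  Real.rpow_pos_of_pos (by positivity) _

theorem HSpace.incl_injective (n : ℕ) (a : ℝ) : Function.Injective (HSpace.incl n a) :=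
  Subtype.coe_injective

theorem HSpace.weighted_injective (n : ℕ) (a : ℝ) :
    Function.Injective (HSpace.weighted n a) := by
  intro u v huv
  have h := (MemLp.toLp_eq_toLp_iff (HSpace.memLp_weighted u)
    (HSpace.memLp_weighted v)).mp huv
  apply HSpace.incl_injective n a
  apply (Lp.fourierTransformₗᵢ (SpaceTime n) ℂ).injective
  apply Lp.ext
  filter_upwards [h] with ζ hζ
  have hw : (weight a ζ : ℂ) ≠ 0 := by exact_mod_cast (weight_pos a ζ).ne'
  exact mul_left_cancel₀ hw hζ

/-- The norm of `𝓗ᵃ(ℝⁿ⁺¹)`: `‖u‖² = ∫ (1 + |i ρ + |ξ|²|) ^ a |û|²`. -/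
instance (n : ℕ) (a : ℝ) : NormedAddCommGroup (HSpace n a) :=
  NormedAddCommGroup.induced _ _ (HSpace.weighted n a) (HSpace.weighted_injective n a)

instance (n : ℕ) (a : ℝ) : NormedSpace ℂ (HSpace n a) :=
  NormedSpace.induced ℂ _ _ (HSpace.weighted n a)

/-- The subspace `𝓗ᵃ_E` of the functions in `𝓗ᵃ(ℝⁿ⁺¹)` that are supported in `E` (for `E` closed):
they vanish almost everywhere outside `E`. -/
def HSupp (n : ℕ) (a : ℝ) (E : Set (SpaceTime n)) : Submodule ℂ (HSpace n a) where
  carrier := {u | ∀ᵐ z : SpaceTime n, z ∉ E → (u : L2 n) z = 0}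
  zero_mem' := by
    simp only [Set.mem_ofPred_eq, map_zero]
    filter_upwards [Lp.coeFn_zero ℂ 2 (volume : Measure (SpaceTime n))] with z hz _
    simp only [hz, Pi.zero_apply]
  add_mem' := by
    intro u v hu hv
    simp only [Set.mem_ofPred_eq, map_add]
    filter_upwards [hu, hv, Lp.coeFn_add (u : L2 n) (v : L2 n)] with z h1 h2 h3 hz
    simp only [h3, Pi.add_apply, h1 hz, h2 hz, add_zero]
  smul_mem' := by
    intro c u hu
    simp only [Set.mem_ofPred_eq, map_smul]
    filter_upwards [hu, Lp.coeFn_smul c (u : L2 n)] with z h1 h3 hz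
    simp only [h3, Pi.smul_apply, h1 hz, smul_zero]

open Classical in
/-- The operator `𝓛ᵇ = (∂ₜ - Δ)ᵇ`, that is, the Fourier multiplier `(i ρ + |ξ|²) ^ b`, on the domain
of all `u ∈ L²` with `(i ρ + |ξ|²) ^ b û ∈ L²` (and `0` off that domain). -/
def fracHeat {n : ℕ} (b : ℝ) (u : L2 n) : L2 n :=
  if h : MemLp (fun ζ => heatSymbol ζ ^ (b : ℂ) * (𝓕 u : L2 n) ζ) 2 volume
  then 𝓕⁻ (h.toLp _) else 0

open Classical in
/-- The operator `𝓛ᵇ_* = (-∂ₜ - Δ)ᵇ`, that is, the Fourier multiplier `(-i ρ + |ξ|²) ^ b`, on its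
domain in `L²` (and `0` off that domain). -/
def fracHeatAdj {n : ℕ} (b : ℝ) (u : L2 n) : L2 n :=
  if h : MemLp (fun ζ => conj (heatSymbol ζ) ^ (b : ℂ) * (𝓕 u : L2 n) ζ) 2 volume
  then 𝓕⁻ (h.toLp _) else 0

/-- The cylinder `(-T, T) × Ω`. -/
def cyl {n : ℕ} (T : ℝ) (Ω : Set (EuclideanSpace ℝ (Fin n))) : Set (SpaceTime n) :=
  {z | z.fst ∈ Ioo (-T) T ∧ z.snd ∈ Ω}

/-- The exterior cylinder `(-T, T) × (ℝⁿ ∖ closure Ω)`. -/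
def extCyl {n : ℕ} (T : ℝ) (Ω : Set (EuclideanSpace ℝ (Fin n))) : Set (SpaceTime n) :=
  cyl T (closure Ω)ᶜ

/-- The `L²` pairing `(u, w)_O = ∫_O u w̄`. -/
def pairing {n : ℕ} (O : Set (SpaceTime n)) (u w : SpaceTime n → ℂ) : ℂ :=
  ∫ z in O, u z * conj (w z)

/-- The form `B_Q(u, w) = (𝓛^{s/2} u, 𝓛^{s/2}_* w) + (Q u, w)_{Ω_T}` on `𝓗ˢ(ℝⁿ⁺¹)`. -/
def BForm {n : ℕ} (s T : ℝ) (Ω : Set (EuclideanSpace ℝ (Fin n))) (Q : SpaceTime n → ℝ)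
    (u w : HSpace n s) : ℂ :=
  pairing univ (fracHeat (s / 2) (u : L2 n)) (fracHeatAdj (s / 2) (w : L2 n))
    + pairing (cyl T Ω) (fun z => (Q z : ℂ) * (u : L2 n) z) (w : L2 n)

/-- The antidual `(𝓗ˢ_{closure Ω_T})^*` of bounded conjugate-linear functionals
`w ↦ ⟨F, w⟩`, with the dual norm. -/
abbrev HDual (n : ℕ) (s T : ℝ) (Ω : Set (EuclideanSpace ℝ (Fin n))) : Type :=
  ↥(HSupp n s (closure (cyl T Ω))) →SL[starRingEnd ℂ] ℂ

/-- `g ∈ 𝓗ᵃ(ℝⁿ⁺¹)` restricts to `f` on `O`. -/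
def Extends {n : ℕ} {a : ℝ} {O : Set (SpaceTime n)} (g : HSpace n a)
    (f : Lp ℂ 2 (volume.restrict O)) : Prop :=
  ((g : L2 n) : SpaceTime n → ℂ) =ᵐ[volume.restrict O] f

/-- The space `𝓗ᵃ(O)` of the restrictions to `O` of the functions in `𝓗ᵃ(ℝⁿ⁺¹)`. -/
def HRestr (n : ℕ) (a : ℝ) (O : Set (SpaceTime n)) : Type :=
  {f : Lp ℂ 2 (volume.restrict O) // ∃ g : HSpace n a, Extends g f}

/-- The quotient norm `‖f‖ = inf {‖g‖ : g|_O = f}` of `𝓗ᵃ(O)`. -/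
def HRestr.norm {n : ℕ} {a : ℝ} {O : Set (SpaceTime n)} (f : HRestr n a O) : ℝ :=
  sInf {r : ℝ | ∃ g : HSpace n a, Extends g f.1 ∧ r = ‖g‖}

/-- The cut-off in time `u ↦ χ_{[-T, T]}(t) u`. -/
def timeCut {n : ℕ} (T : ℝ) (u : SpaceTime n → ℂ) : SpaceTime n → ℂ :=
  {z : SpaceTime n | z.fst ∈ Icc (-T) T}.indicator u

/-- `B_Q(u, w) - lam (u, w)_{Ω_T} = ⟨F, w⟩` for all `w ∈ 𝓗ˢ_{closure Ω_T}`. -/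
def WeakEq {n : ℕ} (s T : ℝ) (Ω : Set (EuclideanSpace ℝ (Fin n))) (Q : SpaceTime n → ℝ)
    (lam : ℝ) (F : HDual n s T Ω) (u : HSpace n s) : Prop :=
  ∀ w : ↥(HSupp n s (closure (cyl T Ω))),
    BForm s T Ω Q u w - (lam : ℂ) * pairing (cyl T Ω) (u : L2 n) ((w : HSpace n s) : L2 n) = F w

/-- `u ∈ 𝓗ˢ(ℝⁿ⁺¹)` is a weak solution of the initial exterior value problem
`((∂ₜ - Δ)ˢ + Q - lam) u = F` in `(-T, T) × Ω`, `u = f` in `(-T, T) × (ℝⁿ ∖ closure Ω)`,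
`u = 0` for `t ≤ -T`. Nothing is prescribed for `t ≥ T`. -/
structure IsWeakSolution {n : ℕ} (s T : ℝ) (Ω : Set (EuclideanSpace ℝ (Fin n)))
    (Q : SpaceTime n → ℝ) (lam : ℝ) (F : HDual n s T Ω) (f : HRestr n s (extCyl T Ω))
    (u : HSpace n s) : Prop where
  exterior : Extends u f.1
  initial : ∀ᵐ z : SpaceTime n, z.fst ≤ -T → (u : L2 n) z = 0
  equation : WeakEq s T Ω Q lam F u

/-- `U ∈ 𝓗ˢ(ℝⁿ⁺¹)` is a solution cut off to `[-T, T]`: `U = U_T`, `(U - f)_T ∈ 𝓗ˢ_{closure Ω_T}`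
(for an extension `g` of `f`), and `U` satisfies the weak equation. -/
structure IsCutSolution {n : ℕ} (s T : ℝ) (Ω : Set (EuclideanSpace ℝ (Fin n)))
    (Q : SpaceTime n → ℝ) (lam : ℝ) (F : HDual n s T Ω) (f : HRestr n s (extCyl T Ω))
    (U : HSpace n s) : Prop where
  cut : ((U : L2 n) : SpaceTime n → ℂ) =ᵐ[volume] timeCut T (U : L2 n)
  exterior : ∃ g : HSpace n s, Extends g f.1 ∧ ∃ v ∈ HSupp n s (closure (cyl T Ω)),
    ((v : L2 n) : SpaceTime n → ℂ) =ᵐ[volume]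
      timeCut T (((U : L2 n) : SpaceTime n → ℂ) - ((g : L2 n) : SpaceTime n → ℂ))
  equation : WeakEq s T Ω Q lam F U

/-- Well-posedness of the initial exterior value problem for `(∂ₜ - Δ)ˢ + Q - lam`: there is exactly
one cut-off solution `U`, with a stability estimate; `U` is itself a weak solution, and every weak
solution coincides with it for `t ≤ T`. -/
def WellPosed {n : ℕ} (s T : ℝ) (Ω : Set (EuclideanSpace ℝ (Fin n))) (Q : SpaceTime n → ℝ)
    (lam : ℝ) : Prop :=
  ∃ C : ℝ, 0 < C ∧ ∀ (F : HDual n s T Ω) (f : HRestr n s (extCyl T Ω)),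
    ∃ U : HSpace n s,
      IsCutSolution s T Ω Q lam F f U ∧
      (∀ U' : HSpace n s, IsCutSolution s T Ω Q lam F f U' → U' = U) ∧
      IsWeakSolution s T Ω Q lam F f U ∧
      (∀ u : HSpace n s, IsWeakSolution s T Ω Q lam F f u →
        ∀ᵐ z : SpaceTime n, z.fst ≤ T → (u : L2 n) z = (U : L2 n) z) ∧
      ‖U‖ ≤ C * (‖F‖ + f.norm)

/-- The eigenvalue condition: if `u ∈ 𝓗ˢ(ℝⁿ⁺¹)` solves `(𝓛ˢ + Q) u = 0` in `Ω_T`, with `u = 0` in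
`(-T, T) × (ℝⁿ ∖ closure Ω)` and for `t ≤ -T`, then `u = 0` in `(-∞, T) × ℝⁿ`. -/
def EigenvalueCondition {n : ℕ} (s T : ℝ) (Ω : Set (EuclideanSpace ℝ (Fin n)))
    (Q : SpaceTime n → ℝ) : Prop :=
  ∀ u : HSpace n s,
    (∀ w ∈ HSupp n s (closure (cyl T Ω)), BForm s T Ω Q u w = 0) →
    (∀ᵐ z : SpaceTime n, z ∈ extCyl T Ω → (u : L2 n) z = 0) →
    (∀ᵐ z : SpaceTime n, z.fst ≤ -T → (u : L2 n) z = 0) →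
    ∀ᵐ z : SpaceTime n, z.fst < T → (u : L2 n) z = 0

end FracHeat

end

/-!
The problem turns out to be well-posed at *every* real `lam`, and the eigenvalue condition holds for
*every* bounded potential (`wellPosed`, `eigenvalueCondition`). The reason is that `(∂ₜ - Δ) ^ s` with
vanishing past is a causal (Volterra) operator, so that it has no eigenvalues: the exceptional set of
the theorem may be any sequence of positive numbers tending to infinity, and `k + 1` is used.

The mechanism is Balakrishnan's subordination formula. With `P τ` the translation in time by `τ`
composed with the heat flow in space at time `τ`, and `c = ∫ (1 - e⁻ᵗ) t ^ (-1 - s) dt`,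
`c (iρ + |ξ|²) ^ s = ∫ (1 - exp (-τ (iρ + |ξ|²))) τ ^ (-1 - s) dτ` gives
`c ((∂ₜ - Δ) ^ s u, w) = ∫ ((u, w) - (P τ u, w)) τ ^ (-1 - s) dτ`
(`integral_levy_one_sub_exp`, `integral_inner_sub_heatPairing`), where `P τ` is a Gaussian average of
space-time translations. Everything is read off from translations.

* *Causality* (`mainForm_eq_zero_of_causal`). If `u` vanishes before `T` and `w` after `T`, then
  `(P τ u, w) = 0` for `τ > 0`. Hence values at times `t > T` do not matter.
* *Coercivity after conjugation* (`mainForm_exp_re_ge`). Conjugation by `exp (μ t)` replaces `P τ` by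
  `exp (-μ τ) P τ`. As `P τ` is a contraction, the real part of the conjugated form dominates both
  `μ ^ s ‖v‖²` and the seminorm of `𝓗ˢ`, so that for large `μ` it absorbs any bounded potential,
  and the Lax-Milgram argument applies (`weak_solvability`).
* *Multipliers in time* (`exists_mul_HSpace`). The seminorm of `𝓗ˢ` is equivalent to
  `∫∫ ‖u(· - h) - u‖² dν(h)`, with `ν` the Lévy measure on space-time displacements `h` that underlies
  `P τ` (`energy_eq`). This yields boundedness on `𝓗ˢ` of multiplication by Lipschitz functions of
  time, such as the truncated exponentials, and, by a Hardy inequality that uses `s < 1`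
  (`lintegral_slabMass_le`), of the cut-off `u ↦ u_T` (`exists_timeCut_HSpace`).

The solution is then `v + g_T`, where `g` extends the exterior datum and `v` is supported in the
closed cylinder. Causality shows that the cut-off of any weak solution is a cut-off solution, and
uniqueness of the latter gives the rest.
-/

open MeasureTheory Filter Set
open scoped FourierTransform ENNReal ComplexConjugate Topology

noncomputable section

namespace FracHeat

/-! ### The stable Lévy measure -/

/-- The measure `τ ^ (-1 - s) dτ` on `(0, ∞)`. -/
def levy (s : ℝ) : Measure ℝ :=
  (volume.restrict (Ioi 0)).withDensity fun τ => ENNReal.ofReal (τ ^ (-1 - s))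

instance (s : ℝ) : SigmaFinite (levy s) := by
  unfold levy; exact SigmaFinite.withDensity_ofReal _

theorem ae_levy_pos (s : ℝ) : ∀ᵐ τ ∂levy s, 0 < τ :=
  (withDensity_absolutelyContinuous _ _).ae_le (ae_restrict_mem measurableSet_Ioi)

theorem lintegral_levy (s : ℝ) {f : ℝ → ℝ≥0∞} (hf : Measurable f) :
    ∫⁻ τ, f τ ∂levy s = ∫⁻ τ in Ioi 0, ENNReal.ofReal (τ ^ (-1 - s)) * f τ := by
  rw [levy, lintegral_withDensity_eq_lintegral_mul _ (by fun_prop) hf]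
  rfl

theorem integrable_levy_iff (s : ℝ) {E : Type*} [NormedAddCommGroup E] [NormedSpace ℝ E]
    {f : ℝ → E} :
    Integrable f (levy s) ↔ IntegrableOn (fun τ => τ ^ (-1 - s) • f τ) (Ioi 0) := by
  rw [levy, integrable_withDensity_iff_integrable_smul' (by fun_prop) (by simp), IntegrableOn]
  apply integrable_congr
  filter_upwards [ae_restrict_mem measurableSet_Ioi] with τ hτ
  rw [ENNReal.toReal_ofReal (Real.rpow_nonneg (le_of_lt hτ) _)]

/-- The Lévy measure is homogeneous of degree `-s`. -/
theorem map_mul_levy (s : ℝ) {r : ℝ} (hr : 0 < r) :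
    (levy s).map (fun τ => r * τ) = ENNReal.ofReal (r ^ s) • levy s := by
  refine Measure.ext_of_lintegral _ fun f hf => ?_
  rw [lintegral_map hf (by fun_prop), lintegral_smul_measure, lintegral_levy s (by fun_prop),
    lintegral_levy s hf]
  have hmap : (volume : Measure ℝ).map (fun τ => r * τ) = ENNReal.ofReal |r⁻¹| • volume :=
    Real.map_volume_mul_left hr.ne'
  rw [← lintegral_indicator measurableSet_Ioi, ← lintegral_indicator measurableSet_Ioi]
  set g : ℝ → ℝ≥0∞ := (Ioi 0).indicator fun τ => ENNReal.ofReal (τ ^ (-1 - s)) * f τ with hg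
  have hgm : Measurable g := (by fun_prop : Measurable fun τ : ℝ =>
    ENNReal.ofReal (τ ^ (-1 - s)) * f τ).indicator measurableSet_Ioi
  have h1 : ∀ τ, (Ioi (0 : ℝ)).indicator (fun τ => ENNReal.ofReal (τ ^ (-1 - s)) * f (r * τ)) τ
      = ENNReal.ofReal (r ^ (1 + s)) * g (r * τ) := by
    intro τ
    by_cases hτ : 0 < τ
    · have hrτ : 0 < r * τ := mul_pos hr hτ
      rw [hg, indicator_of_mem (mem_Ioi.2 hτ), indicator_of_mem (mem_Ioi.2 hrτ), ← mul_assoc,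
        ← ENNReal.ofReal_mul (by positivity), Real.mul_rpow hr.le hτ.le, ← mul_assoc,
        ← Real.rpow_add hr, show 1 + s + (-1 - s) = 0 by ring, Real.rpow_zero, one_mul]
    · have hrτ : ¬ 0 < r * τ := by
        simpa using mul_nonpos_of_nonneg_of_nonpos hr.le (not_lt.1 hτ)
      rw [hg, indicator_of_notMem (by simpa using hτ), indicator_of_notMem (by simpa using hrτ),
        mul_zero]
  rw [lintegral_congr h1, lintegral_const_mul _ (show Measurable fun τ => g (r * τ) by fun_prop)]
  rw [← lintegral_map hgm (by fun_prop), hmap, lintegral_smul_measure, smul_eq_mul, smul_eq_mul,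
    ← mul_assoc, ← ENNReal.ofReal_mul (by positivity), abs_of_pos (inv_pos.2 hr),
    Real.rpow_add hr, Real.rpow_one]
  congr 2
  field_simp

theorem lintegral_levy_comp_mul (s : ℝ) {r : ℝ} (hr : 0 < r) {f : ℝ → ℝ≥0∞} (hf : Measurable f) :
    ∫⁻ τ, f (r * τ) ∂levy s = ENNReal.ofReal (r ^ s) * ∫⁻ τ, f τ ∂levy s := by
  rw [← smul_eq_mul, ← lintegral_smul_measure, ← map_mul_levy s hr,
    lintegral_map hf (by fun_prop)]

theorem integral_levy_comp_mul (s : ℝ) {r : ℝ} (hr : 0 < r) {f : ℝ → ℂ}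
    (hf : Measurable f) :
    ∫ τ, f (r * τ) ∂levy s = (r ^ s : ℝ) * ∫ τ, f τ ∂levy s := by
  have h := integral_map (μ := levy s) (φ := fun τ => r * τ) (by fun_prop)
    (f := f) hf.aestronglyMeasurable
  rw [← h, map_mul_levy s hr, integral_smul_measure,
    ENNReal.toReal_ofReal (Real.rpow_nonneg hr.le _), Complex.real_smul]

theorem integrable_min_levy {s : ℝ} (hs0 : 0 < s) (hs1 : s < 1) :
    Integrable (fun τ => min 1 τ) (levy s) := by
  rw [integrable_levy_iff, ← Ioc_union_Ioi_eq_Ioi zero_le_one, integrableOn_union]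
  constructor
  · have h : IntegrableOn (fun τ : ℝ => τ ^ (-s)) (Ioc 0 1) := by
      rw [← intervalIntegrable_iff_integrableOn_Ioc_of_le zero_le_one]
      exact intervalIntegral.intervalIntegrable_rpow' (by linarith)
    refine h.congr_fun (fun τ hτ => ?_) measurableSet_Ioc
    simp only [min_eq_right hτ.2, smul_eq_mul]
    rw [← Real.rpow_add_one hτ.1.ne']
    congr 1; ring
  · refine (integrableOn_Ioi_rpow_of_lt (by linarith : -1 - s < -1) one_pos).congr_fun
      (fun τ hτ => ?_) measurableSet_Ioi
    simp [min_eq_left (le_of_lt (mem_Ioi.1 hτ))]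

theorem levy_Ioi_lt_top {s : ℝ} (hs0 : 0 < s) {δ : ℝ} (hδ : 0 < δ) : levy s (Ioi δ) < ∞ := by
  rw [levy, withDensity_apply _ measurableSet_Ioi, Measure.restrict_restrict measurableSet_Ioi,
    inter_eq_self_of_subset_left (Ioi_subset_Ioi hδ.le)]
  exact (integrableOn_Ioi_rpow_of_lt (by linarith : -1 - s < -1) hδ).lintegral_lt_top

theorem levy_ne_zero (s : ℝ) : levy s ≠ 0 := by
  intro h
  rw [levy, withDensity_eq_zero_iff (by fun_prop)] at h
  have h2 := h.and (ae_restrict_mem measurableSet_Ioi)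
  have h3 : ∀ᵐ τ ∂(volume.restrict (Ioi (0 : ℝ))), False := by
    filter_upwards [h2] with τ hτ
    have := hτ.1
    simp only [Pi.zero_apply, ENNReal.ofReal_eq_zero] at this
    exact absurd this (not_le.2 (Real.rpow_pos_of_pos hτ.2 _))
  rw [eventually_false_iff_eq_bot, ae_eq_bot, Measure.restrict_eq_zero] at h3
  simp at h3

theorem norm_one_sub_exp_neg_le {z : ℂ} (hz : 0 ≤ z.re) :
    ‖1 - Complex.exp (-z)‖ ≤ 2 * min 1 ‖z‖ := by
  rcases le_total 1 ‖z‖ with h | h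
  · rw [min_eq_left h]
    calc ‖1 - Complex.exp (-z)‖ ≤ ‖(1 : ℂ)‖ + ‖Complex.exp (-z)‖ := norm_sub_le _ _
      _ ≤ 1 + 1 := by
        rw [norm_one, Complex.norm_exp]
        gcongr
        exact Real.exp_le_one_iff.2 (by simpa using hz)
      _ = 2 * 1 := by norm_num
  · rw [min_eq_right h, norm_sub_rev]
    simpa using Complex.norm_exp_sub_one_le (x := -z) (by simpa using h)

theorem norm_one_sub_exp_neg_mul_le {z : ℂ} (hz : 0 ≤ z.re) {τ : ℝ} (hτ : 0 ≤ τ) :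
    ‖1 - Complex.exp (-(τ * z))‖ ≤ 2 * min 1 (‖z‖ * τ) := by
  have h := norm_one_sub_exp_neg_le (z := τ * z) (by simpa using mul_nonneg hτ hz)
  rwa [norm_mul, Complex.norm_real, Real.norm_of_nonneg hτ, mul_comm τ] at h

theorem integrable_min_mul_levy {s : ℝ} (hs0 : 0 < s) (hs1 : s < 1) {r : ℝ} (hr : 0 ≤ r) :
    Integrable (fun τ => min 1 (r * τ)) (levy s) := by
  refine ((integrable_min_levy hs0 hs1).const_mul (max 1 r)).mono'
    (by fun_prop) ?_
  filter_upwards [ae_levy_pos s] with τ hτ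
  rw [Real.norm_of_nonneg (by positivity)]
  rcases le_total 1 τ with h | h
  · rw [min_eq_left h, mul_one]
    exact (min_le_left _ _).trans (le_max_left _ _)
  · rw [min_eq_right h]
    exact (min_le_right _ _).trans (by gcongr; exact le_max_right _ _)

theorem integrable_one_sub_exp_levy {s : ℝ} (hs0 : 0 < s) (hs1 : s < 1) {z : ℂ} (hz : 0 ≤ z.re) :
    Integrable (fun τ : ℝ => 1 - Complex.exp (-(τ * z))) (levy s) := by
  refine ((integrable_min_mul_levy hs0 hs1 (norm_nonneg z)).const_mul 2).mono' (by fun_prop) ?_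
  filter_upwards [ae_levy_pos s] with τ hτ
  exact norm_one_sub_exp_neg_mul_le hz hτ.le

/-- The constant `∫ (1 - e⁻ᵗ) t ^ (-1 - s) dt = Γ(1 - s) / s`. -/
def levyConst (s : ℝ) : ℝ := ∫ τ, (1 - Real.exp (-τ)) ∂levy s

theorem integrable_one_sub_rexp_levy {s : ℝ} (hs0 : 0 < s) (hs1 : s < 1) {r : ℝ} (hr : 0 ≤ r) :
    Integrable (fun τ : ℝ => 1 - Real.exp (-(τ * r))) (levy s) := by
  have h := (integrable_one_sub_exp_levy hs0 hs1 (z := r) (by simpa using hr)).re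
  refine h.congr (Eventually.of_forall fun τ => ?_)
  simp only [RCLike.re_to_complex, Complex.sub_re, Complex.one_re]
  rw [← Complex.ofReal_mul, ← Complex.ofReal_neg, Complex.exp_ofReal_re]

theorem levyConst_pos {s : ℝ} (hs0 : 0 < s) (hs1 : s < 1) : 0 < levyConst s := by
  have hi : Integrable (fun τ : ℝ => 1 - Real.exp (-τ)) (levy s) := by
    simpa using integrable_one_sub_rexp_levy hs0 hs1 (r := 1) zero_le_one
  have hpos : ∀ᵐ τ ∂levy s, 0 < 1 - Real.exp (-τ) := by
    filter_upwards [ae_levy_pos s] with τ hτ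
    simpa using hτ
  rw [levyConst, integral_pos_iff_support_of_nonneg_ae (hpos.mono fun _ h => h.le) hi,
    pos_iff_ne_zero]
  intro h0
  apply levy_ne_zero s
  rw [← ae_eq_bot, ← eventually_false_iff_eq_bot]
  have h1 : ∀ᵐ τ ∂levy s, τ ∉ Function.support fun τ : ℝ => 1 - Real.exp (-τ) :=
    measure_eq_zero_iff_ae_notMem.1 h0
  filter_upwards [h1, hpos] with τ h2 h3
  exact h2 h3.ne'

theorem differentiableOn_integral_levy {s : ℝ} (hs0 : 0 < s) (hs1 : s < 1) :
    DifferentiableOn ℂ (fun z : ℂ => ∫ τ, (1 - Complex.exp (-((τ : ℝ) * z))) ∂levy s)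
      {z | 0 < z.re} := by
  intro z hz
  have hz : 0 < z.re := hz
  set ε := z.re / 2 with hε
  have hε0 : 0 < ε := by positivity
  have key := hasDerivAt_integral_of_dominated_loc_of_deriv_le (μ := levy s)
    (F := fun (z : ℂ) (τ : ℝ) => 1 - Complex.exp (-(τ * z)))
    (F' := fun (z : ℂ) (τ : ℝ) => τ * Complex.exp (-(τ * z)))
    (bound := fun τ => max 1 ε⁻¹ * min 1 τ) (x₀ := z)
    (s := {w | ε < w.re}) ?_ (Eventually.of_forall fun w => by fun_prop)
    (integrable_one_sub_exp_levy hs0 hs1 hz.le) (by fun_prop) ?_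
    ((integrable_min_levy hs0 hs1).const_mul _) ?_
  · exact key.2.differentiableAt.differentiableWithinAt
  · exact (isOpen_lt continuous_const Complex.continuous_re).mem_nhds
      (by simp only [mem_ofPred_eq, hε]; linarith)
  · filter_upwards [ae_levy_pos s] with τ hτ w hw
    have hw : ε < w.re := hw
    rw [norm_mul, Complex.norm_real, Real.norm_of_nonneg hτ.le, Complex.norm_exp]
    have hre : (-(τ * w) : ℂ).re ≤ -(ε * τ) := by
      simp only [Complex.neg_re, Complex.mul_re, Complex.ofReal_re, Complex.ofReal_im]
      nlinarith
    have h1 : Real.exp (-(τ * w) : ℂ).re ≤ Real.exp (-(ε * τ)) := Real.exp_le_exp.2 hre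
    rcases le_total 1 τ with h | h
    · rw [min_eq_left h, mul_one]
      refine le_trans ?_ (le_max_right _ _)
      calc τ * Real.exp (-(τ * w) : ℂ).re ≤ τ * Real.exp (-(ε * τ)) := by gcongr
        _ ≤ ε⁻¹ := by
          rw [Real.exp_neg, ← div_eq_mul_inv, div_le_iff₀ (Real.exp_pos _), inv_mul_eq_div,
            le_div_iff₀ hε0]
          linarith [Real.add_one_le_exp (ε * τ)]
    · rw [min_eq_right h]
      have h2 : Real.exp (-(τ * w) : ℂ).re ≤ 1 :=
        h1.trans (Real.exp_le_one_iff.2 (by nlinarith))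
      calc τ * Real.exp (-(τ * w) : ℂ).re ≤ τ * 1 := by gcongr
        _ ≤ max 1 ε⁻¹ * τ := by rw [mul_one]; nlinarith [le_max_left 1 ε⁻¹]
  · refine Eventually.of_forall fun τ w _ => ?_
    have h1 : HasDerivAt (fun w : ℂ => -(τ * w)) (-(τ : ℂ)) w := by
      simpa using ((hasDerivAt_id w).const_mul (τ : ℂ)).fun_neg
    have h2 := (h1.cexp).const_sub 1
    convert h2 using 1
    ring

/-- The subordination formula for the principal branch of `z ^ s` on the right half plane.
Homogeneity of the Lévy measure gives it on `(0, ∞)`, and both sides are holomorphic. -/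
theorem integral_levy_one_sub_exp {s : ℝ} (hs0 : 0 < s) (hs1 : s < 1) {z : ℂ} (hz : 0 < z.re) :
    ∫ τ, (1 - Complex.exp (-((τ : ℝ) * z))) ∂levy s = levyConst s * z ^ (s : ℂ) := by
  have hopen : IsOpen {z : ℂ | 0 < z.re} := isOpen_lt continuous_const Complex.continuous_re
  have hf := (differentiableOn_integral_levy hs0 hs1).analyticOnNhd hopen
  have hg : AnalyticOnNhd ℂ (fun z : ℂ => (levyConst s : ℂ) * z ^ (s : ℂ)) {z | 0 < z.re} := by
    refine DifferentiableOn.analyticOnNhd (fun w hw => ?_) hopen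
    have hw : 0 < w.re := hw
    exact ((differentiableAt_id.cpow_const (Or.inl hw)).const_mul _).differentiableWithinAt
  have hconv : Convex ℝ {z : ℂ | 0 < z.re} := convex_halfSpace_re_gt 0
  have hreal : ∀ r : ℝ, 0 < r →
      ∫ τ, (1 - Complex.exp (-((τ : ℝ) * (r : ℂ)))) ∂levy s = levyConst s * (r : ℂ) ^ (s : ℂ) := by
    intro r hr
    have h := integral_levy_comp_mul s hr (f := fun τ => 1 - Complex.exp (-(τ : ℂ))) (by fun_prop)
    have hc : (levyConst s : ℂ) = ∫ τ, (1 - Complex.exp (-((τ : ℝ) : ℂ))) ∂levy s := by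
      rw [levyConst, ← integral_complex_ofReal]
      exact integral_congr_ae (Eventually.of_forall fun τ => by push_cast; rfl)
    rw [← Complex.ofReal_cpow hr.le, mul_comm, hc, ← h]
    refine integral_congr_ae (Eventually.of_forall fun τ => ?_)
    push_cast
    ring_nf
  refine hf.eqOn_of_preconnected_of_frequently_eq hg hconv.isPreconnected (z₀ := 1)
    (by simp) ?_ hz
  have ht : Tendsto (fun r : ℝ => (r : ℂ)) (𝓝[>] 1) (𝓝[≠] 1) := by
    refine tendsto_nhdsWithin_iff.2 ⟨?_, ?_⟩
    · exact (Complex.continuous_ofReal.tendsto' 1 1 (by simp)).mono_left nhdsWithin_le_nhds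
    · filter_upwards [self_mem_nhdsWithin] with r hr
      have hr : (1 : ℝ) < r := hr
      simpa using hr.ne'
  refine ht.frequently (Eventually.frequently ?_)
  filter_upwards [self_mem_nhdsWithin] with r hr
  exact hreal r (one_pos.trans hr)

/-- A bound of size `|z| ^ s` for the absolute subordination integral. -/
theorem lintegral_levy_one_sub_exp_le (s : ℝ) {z : ℂ} (hz : 0 ≤ z.re)
    (hz0 : z ≠ 0) :
    ∫⁻ τ, ‖1 - Complex.exp (-((τ : ℝ) * z))‖ₑ ∂levy s
      ≤ ENNReal.ofReal (‖z‖ ^ s) * ∫⁻ τ, ENNReal.ofReal (2 * min 1 τ) ∂levy s := by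
  rw [← lintegral_levy_comp_mul s (norm_pos_iff.2 hz0) (by fun_prop)]
  refine lintegral_mono_ae ?_
  filter_upwards [ae_levy_pos s] with τ hτ
  rw [← ofReal_norm]
  exact ENNReal.ofReal_le_ofReal (norm_one_sub_exp_neg_mul_le hz hτ.le)

/-! ### The heat symbol -/

theorem heatSymbol_re {n : ℕ} (ζ : SpaceTime n) :
    (heatSymbol ζ).re = (2 * Real.pi * ‖ζ.snd‖) ^ 2 := by
  simp only [heatSymbol, Complex.add_re, Complex.mul_re, Complex.I_re, Complex.I_im,
    Complex.ofReal_re, Complex.ofReal_im]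
  ring

theorem heatSymbol_re_nonneg {n : ℕ} (ζ : SpaceTime n) : 0 ≤ (heatSymbol ζ).re := by
  rw [heatSymbol_re]; positivity

@[fun_prop]
theorem continuous_heatSymbol {n : ℕ} : Continuous (heatSymbol : SpaceTime n → ℂ) := by
  have h1 : Continuous fun ζ : SpaceTime n => ζ.fst := WithLp.continuous_fst 2 _ _
  have h2 : Continuous fun ζ : SpaceTime n => ζ.snd := WithLp.continuous_snd 2 _ _
  unfold heatSymbol
  fun_prop

@[fun_prop]
theorem measurable_heatSymbol {n : ℕ} : Measurable (heatSymbol : SpaceTime n → ℂ) :=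
  continuous_heatSymbol.measurable

@[fun_prop]
theorem measurable_fst_spaceTime {n : ℕ} : Measurable fun z : SpaceTime n => z.fst :=
  (WithLp.continuous_fst 2 _ _).measurable

@[fun_prop]
theorem measurable_weight {n : ℕ} (a : ℝ) : Measurable (weight a : SpaceTime n → ℝ) := by
  unfold weight; fun_prop

theorem ae_fst_ne {n : ℕ} (a : ℝ) : ∀ᵐ z : SpaceTime n, z.fst ≠ a := by
  have h := (WithLp.volume_preserving_ofLp ℝ (EuclideanSpace ℝ (Fin n)))
  have h2 : ∀ᵐ p : ℝ × EuclideanSpace ℝ (Fin n), p.1 ≠ a :=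
    Measure.quasiMeasurePreserving_fst.ae (Measure.ae_ne volume a)
  exact h.quasiMeasurePreserving.ae h2

theorem ae_heatSymbol_re_pos {n : ℕ} (hn : 1 ≤ n) :
    ∀ᵐ ζ : SpaceTime n, 0 < (heatSymbol ζ).re := by
  have : Nonempty (Fin n) := ⟨⟨0, hn⟩⟩
  have h := (WithLp.volume_preserving_ofLp ℝ (EuclideanSpace ℝ (Fin n)))
  have h2 : ∀ᵐ p : ℝ × EuclideanSpace ℝ (Fin n), p.2 ≠ 0 :=
    Measure.quasiMeasurePreserving_snd.ae (Measure.ae_ne volume 0)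
  filter_upwards [h.quasiMeasurePreserving.ae h2] with ζ hζ
  have : 0 < ‖ζ.snd‖ := norm_pos_iff.2 hζ
  rw [heatSymbol_re]
  positivity

/-! ### Translations -/

/-- Translation `u ↦ u(· - h)` on `L²`. -/
def translate {n : ℕ} (h : SpaceTime n) : L2 n →ₗᵢ[ℂ] L2 n :=
  Lp.compMeasurePreservingₗᵢ ℂ (fun z => z - h) (measurePreserving_sub_right volume h)

theorem coeFn_translate {n : ℕ} (h : SpaceTime n) (u : L2 n) :
    translate h u =ᵐ[volume] fun z => (u : SpaceTime n → ℂ) (z - h) :=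
  Lp.coeFn_compMeasurePreserving u (measurePreserving_sub_right volume h)

/-- The character `ζ ↦ exp (-2πi ⟨h, ζ⟩)`. -/
def phase {n : ℕ} (h ζ : SpaceTime n) : ℂ :=
  Complex.exp (-(2 * Real.pi * inner ℝ h ζ : ℝ) * Complex.I)

theorem norm_phase {n : ℕ} (h ζ : SpaceTime n) : ‖phase h ζ‖ = 1 := by
  rw [phase, ← Complex.ofReal_neg, Complex.norm_exp_ofReal_mul_I]

@[fun_prop]
theorem continuous_phase {n : ℕ} :
    Continuous fun p : SpaceTime n × SpaceTime n => phase p.1 p.2 := by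
  unfold phase
  fun_prop

/-- Multiplication by an essentially bounded function on `L²`. -/
def mulLp {n : ℕ} {φ : SpaceTime n → ℂ} (hφ : MemLp φ ∞ volume) : L2 n →L[ℂ] L2 n :=
  (ContinuousLinearMap.mul ℂ ℂ).holderL volume ∞ 2 2 (hφ.toLp φ)

theorem coeFn_mulLp {n : ℕ} {φ : SpaceTime n → ℂ} (hφ : MemLp φ ∞ volume) (u : L2 n) :
    mulLp hφ u =ᵐ[volume] fun z => φ z * (u : SpaceTime n → ℂ) z := by
  have h := (ContinuousLinearMap.mul ℂ ℂ).coeFn_holder (r := 2) (hφ.toLp φ) u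
  filter_upwards [h, hφ.coeFn_toLp] with z h1 h2
  simpa [h2, mulLp] using h1

theorem memLp_phase {n : ℕ} (h : SpaceTime n) : MemLp (phase h) ∞ volume :=
  memLp_top_of_bound (continuous_phase.comp (Continuous.prodMk_right h)).aestronglyMeasurable 1
    (Eventually.of_forall fun ζ => (norm_phase h ζ).le)

theorem fourier_translate {n : ℕ} (h : SpaceTime n) (u : L2 n) :
    (𝓕 (translate h u) : L2 n) = mulLp (memLp_phase h) (𝓕 u) := by
  let p := fun u : L2 n => (𝓕 (translate h u) : L2 n) = mulLp (memLp_phase h) (𝓕 u)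
  apply DenseRange.induction_on (p := p)
    (SchwartzMap.denseRange_toLpCLM (p := 2) ENNReal.ofNat_ne_top) u
  · apply isClosed_eq
    · exact (Lp.fourierTransformₗᵢ (SpaceTime n) ℂ).continuous.comp (translate h).continuous
    · exact (mulLp (memLp_phase h)).continuous.comp
        (Lp.fourierTransformₗᵢ (SpaceTime n) ℂ).continuous
  intro f
  simp only [p, SchwartzMap.toLpCLM_apply]
  have h1 : translate h (f.toLp 2) = (SchwartzMap.compSubConstCLM ℂ h f).toLp 2 := by
    apply Lp.ext
    have h0 := (measurePreserving_sub_right volume h).quasiMeasurePreserving.ae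
      (f.coeFn_toLp 2 (volume : Measure (SpaceTime n)))
    filter_upwards [coeFn_translate h (f.toLp 2), h0,
      (SchwartzMap.compSubConstCLM ℂ h f).coeFn_toLp 2 volume] with z h1 h2 h3
    rw [h1, h3, h2]
    rfl
  rw [h1, SchwartzMap.toLp_fourier_eq, SchwartzMap.toLp_fourier_eq]
  apply Lp.ext
  filter_upwards [(𝓕 (SchwartzMap.compSubConstCLM ℂ h f)).coeFn_toLp 2 volume,
    (𝓕 f).coeFn_toLp 2 volume, coeFn_mulLp (memLp_phase h) ((𝓕 f).toLp 2)] with ζ h2 h3 h4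
  rw [h2, h4, h3, SchwartzMap.fourier_coe, SchwartzMap.fourier_coe]
  have h5 := congrFun (VectorFourier.fourierIntegral_comp_add_right Real.fourierChar volume
    (innerₗ (SpaceTime n)) f (-h)) ζ
  have h6 : ((f : SpaceTime n → ℂ) ∘ fun v => v + -h) = SchwartzMap.compSubConstCLM ℂ h f := by
    ext z; simp [sub_eq_add_neg]
  rw [h6] at h5
  rw [Real.fourier_eq', Real.fourier_eq']
  simp only [VectorFourier.fourierIntegral, Real.fourierChar_apply, Circle.smul_def] at h5
  simp [phase] at h5 ⊢
  have e (a b : ℂ) : 2 * Real.pi * (-a + -b) * Complex.I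
      = -(2 * Real.pi * (b + a) * Complex.I) := by ring
  simpa only [e] using h5

theorem inner_translate {n : ℕ} (h : SpaceTime n) (u w : L2 n) :
    inner ℂ w (translate h u) = ∫ ζ, phase h ζ * ((𝓕 u : L2 n) ζ * conj ((𝓕 w : L2 n) ζ)) := by
  rw [← Lp.inner_fourier_eq, fourier_translate, L2.inner_def]
  refine integral_congr_ae ?_
  filter_upwards [coeFn_mulLp (memLp_phase h) (𝓕 u : L2 n)] with ζ hζ
  rw [hζ, RCLike.inner_apply]
  ring

theorem enorm_sq_eq_lintegral {n : ℕ} (u : L2 n) : ‖u‖ₑ ^ 2 = ∫⁻ z, ‖u z‖ₑ ^ 2 := by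
  rw [Lp.enorm_def, eLpNorm_eq_lintegral_rpow_enorm_toReal (by norm_num) (by norm_num)]
  simp only [ENNReal.toReal_ofNat, ENNReal.rpow_ofNat, one_div]
  rw [← ENNReal.rpow_natCast, ← ENNReal.rpow_mul]
  simp

theorem enorm_translate_sub_sq {n : ℕ} (h : SpaceTime n) (u : L2 n) :
    ‖translate h u - u‖ₑ ^ 2 = ∫⁻ ζ, ‖phase h ζ - 1‖ₑ ^ 2 * ‖(𝓕 u : L2 n) ζ‖ₑ ^ 2 := by
  have h1 : ‖translate h u - u‖ₑ = ‖(𝓕 (translate h u - u) : L2 n)‖ₑ := by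
    rw [← ofReal_norm, ← ofReal_norm, Lp.norm_fourier_eq]
  have h2 : (𝓕 (translate h u - u) : L2 n) = 𝓕 (translate h u) - 𝓕 u :=
    map_sub (Lp.fourierTransformₗᵢ (SpaceTime n) ℂ) _ _
  rw [h1, h2, enorm_sq_eq_lintegral, fourier_translate]
  refine lintegral_congr_ae ?_
  filter_upwards [coeFn_mulLp (memLp_phase h) (𝓕 u : L2 n),
    Lp.coeFn_sub (mulLp (memLp_phase h) (𝓕 u : L2 n)) (𝓕 u : L2 n)] with ζ h3 h4
  rw [h4, Pi.sub_apply, h3, ← sub_one_mul, enorm_mul, mul_pow]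

/-! ### The space-time Lévy measure of the fractional heat operator -/

/-- The displacement `(τ, √(2τ) y)`; for a standard Gaussian `y`, its spatial part is distributed
according to the heat kernel at time `τ`. -/
def heatShift {n : ℕ} (τ : ℝ) (y : EuclideanSpace ℝ (Fin n)) : SpaceTime n :=
  WithLp.toLp 2 (τ, √(2 * τ) • y)

@[fun_prop]
theorem continuous_heatShift {n : ℕ} :
    Continuous fun p : ℝ × EuclideanSpace ℝ (Fin n) => heatShift p.1 p.2 := by
  unfold heatShift
  exact (WithLp.prod_continuous_toLp 2 _ _).comp (by fun_prop)

theorem measurable_enorm_phase_sub_one {n : ℕ} {α : Type*} [MeasurableSpace α] {f : α → ℝ}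
    {g : α → EuclideanSpace ℝ (Fin n)} {k : α → SpaceTime n} (hf : Measurable f)
    (hg : Measurable g) (hk : Measurable k) :
    Measurable fun a => ‖phase (heatShift (f a) (g a)) (k a) - 1‖ₑ ^ 2 := by
  have h1 : Measurable fun a => heatShift (f a) (g a) := by
    have := continuous_heatShift (n := n).measurable
    exact this.comp (hf.prodMk hg)
  have h2 : Measurable fun a => phase (heatShift (f a) (g a)) (k a) := by
    have h3 := h1.inner (𝕜 := ℝ) hk
    unfold phase
    fun_prop
  have h4 : Measurable fun a => ‖phase (heatShift (f a) (g a)) (k a) - 1‖ₑ :=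
    (h2.sub_const 1).enorm
  exact h4.pow_const 2

/-- The standard Gaussian measure on `ℝⁿ`. -/
abbrev gauss (n : ℕ) : Measure (EuclideanSpace ℝ (Fin n)) := ProbabilityTheory.stdGaussian _

theorem integral_phase_heatShift {n : ℕ} {τ : ℝ} (hτ : 0 ≤ τ) (ζ : SpaceTime n) :
    ∫ y, phase (heatShift τ y) ζ ∂gauss n = Complex.exp (-(τ * heatSymbol ζ)) := by
  have h := ProbabilityTheory.charFun_stdGaussian (-(2 * Real.pi * √(2 * τ)) • ζ.snd)
  rw [charFun_apply] at h
  have h1 : ∀ y, phase (heatShift τ y) ζ = Complex.exp (-(2 * Real.pi * τ * ζ.fst) * Complex.I) *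
      Complex.exp ((inner ℝ y (-(2 * Real.pi * √(2 * τ)) • ζ.snd) : ℝ) * Complex.I) := by
    intro y
    rw [← Complex.exp_add, phase, heatShift, WithLp.prod_inner_apply]
    congr 1
    simp only [WithLp.ofLp_fst, WithLp.ofLp_snd, inner_smul_left, inner_smul_right,
      RCLike.inner_apply]
    simp
    ring
  rw [integral_congr_ae (Eventually.of_forall h1), integral_const_mul, h, ← Complex.exp_add]
  congr 1
  have h2 : ‖-(2 * Real.pi * √(2 * τ)) • ζ.snd‖ ^ 2 = 2 * τ * (2 * Real.pi * ‖ζ.snd‖) ^ 2 := by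
    rw [norm_smul, mul_pow, norm_neg, Real.norm_of_nonneg (by positivity), mul_pow,
      Real.sq_sqrt (by positivity)]
    ring
  rw [← Complex.ofReal_pow, h2, heatSymbol]
  push_cast
  ring

theorem integrable_phase_heatShift {n : ℕ} (τ : ℝ) (ζ : SpaceTime n) :
    Integrable (fun y => phase (heatShift τ y) ζ) (gauss n) := by
  refine Integrable.of_bound (C := 1) (Continuous.aestronglyMeasurable ?_)
    (Eventually.of_forall fun y => (norm_phase _ _).le)
  have : Continuous fun y : EuclideanSpace ℝ (Fin n) => heatShift τ y :=
    continuous_heatShift.comp (Continuous.prodMk_right τ)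
  exact continuous_phase.comp (this.prodMk continuous_const)

theorem lintegral_phase_sub_one_sq {n : ℕ} {τ : ℝ} (hτ : 0 ≤ τ) (ζ : SpaceTime n) :
    ∫⁻ y, ‖phase (heatShift τ y) ζ - 1‖ₑ ^ 2 ∂gauss n
      = ENNReal.ofReal (2 * (1 - Complex.exp (-(τ * heatSymbol ζ))).re) := by
  have h1 : ∀ y, ‖phase (heatShift τ y) ζ - 1‖ₑ ^ 2
      = ENNReal.ofReal (2 - 2 * (phase (heatShift τ y) ζ).re) := by
    intro y
    rw [← ofReal_norm, ← ENNReal.ofReal_pow (norm_nonneg _)]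
    congr 1
    have h := norm_phase (heatShift τ y) ζ
    have h2 : ‖phase (heatShift τ y) ζ‖ ^ 2 = 1 := by rw [h]; norm_num
    rw [Complex.sq_norm, Complex.normSq_apply] at h2 ⊢
    simp only [Complex.sub_re, Complex.one_re, Complex.sub_im, Complex.one_im]
    linarith
  have hi := integrable_phase_heatShift τ ζ
  rw [lintegral_congr h1, ← ofReal_integral_eq_lintegral_ofReal]
  · congr 1
    have hre : ∫ y, (phase (heatShift τ y) ζ).re ∂gauss n
        = (∫ y, phase (heatShift τ y) ζ ∂gauss n).re := integral_re hi
    have hir : Integrable (fun y => (phase (heatShift τ y) ζ).re) (gauss n) := hi.re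
    rw [integral_sub (integrable_const _) (hir.const_mul 2), integral_const_mul, hre,
      integral_phase_heatShift hτ]
    simp
    ring
  · exact (integrable_const _).sub (hi.re.const_mul 2)
  · refine Eventually.of_forall fun y => ?_
    have := (Complex.re_le_norm (phase (heatShift τ y) ζ)).trans (norm_phase _ _).le
    simp only [Pi.zero_apply]
    linarith

/-- The energy `∫∫ ‖u(· - h) - u‖² γ(dy) τ ^ (-1 - s) dτ` over the displacements
`h = (τ, √(2τ) y)`. -/
def energy {n : ℕ} (s : ℝ) (u : L2 n) : ℝ≥0∞ :=
  ∫⁻ τ, ∫⁻ y, ‖translate (heatShift τ y) u - u‖ₑ ^ 2 ∂gauss n ∂levy s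

/-- The energy has the Fourier symbol `2 c Re ((iρ + |ξ|²) ^ s)`. -/
theorem energy_eq {n : ℕ} (hn : 1 ≤ n) {s : ℝ} (hs0 : 0 < s) (hs1 : s < 1) (u : L2 n) :
    energy s u = ∫⁻ ζ, ENNReal.ofReal (2 * levyConst s * (heatSymbol ζ ^ (s : ℂ)).re)
      * ‖(𝓕 u : L2 n) ζ‖ₑ ^ 2 := by
  have hm : AEMeasurable (fun ζ => ‖(𝓕 u : L2 n) ζ‖ₑ ^ 2) (volume : Measure (SpaceTime n)) :=
    (Lp.aestronglyMeasurable _).enorm.pow_const 2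
  have hinner : ∀ τ, 0 < τ → ∫⁻ y, ‖translate (heatShift τ y) u - u‖ₑ ^ 2 ∂gauss n
      = ∫⁻ ζ, ENNReal.ofReal (2 * (1 - Complex.exp (-(τ * heatSymbol ζ))).re)
        * ‖(𝓕 u : L2 n) ζ‖ₑ ^ 2 := by
    intro τ hτ
    simp_rw [enorm_translate_sub_sq]
    have hm1 : Measurable fun q : EuclideanSpace ℝ (Fin n) × SpaceTime n =>
        ‖phase (heatShift τ q.1) q.2 - 1‖ₑ ^ 2 :=
      measurable_enorm_phase_sub_one measurable_const measurable_fst measurable_snd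
    have hm2 : AEMeasurable (fun q : EuclideanSpace ℝ (Fin n) × SpaceTime n =>
        ‖phase (heatShift τ q.1) q.2 - 1‖ₑ ^ 2 * ‖(𝓕 u : L2 n) q.2‖ₑ ^ 2)
        ((gauss n).prod volume) :=
      hm1.aemeasurable.mul (hm.comp_quasiMeasurePreserving Measure.quasiMeasurePreserving_snd)
    rw [lintegral_lintegral_swap hm2]
    refine lintegral_congr fun ζ => ?_
    have hm3 : Measurable fun y => ‖phase (heatShift τ y) ζ - 1‖ₑ ^ 2 :=
      measurable_enorm_phase_sub_one measurable_const measurable_id measurable_const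
    rw [lintegral_mul_const _ hm3, lintegral_phase_sub_one_sq hτ.le]
  have hm4 : AEMeasurable (fun q : ℝ × SpaceTime n =>
      ENNReal.ofReal (2 * (1 - Complex.exp (-(q.1 * heatSymbol q.2))).re)
        * ‖(𝓕 u : L2 n) q.2‖ₑ ^ 2) ((levy s).prod volume) := by
    refine AEMeasurable.mul (Measurable.aemeasurable ?_)
      (hm.comp_quasiMeasurePreserving Measure.quasiMeasurePreserving_snd)
    fun_prop
  rw [energy, lintegral_congr_ae ((ae_levy_pos s).mono hinner), lintegral_lintegral_swap hm4]
  · refine lintegral_congr_ae ?_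
    filter_upwards [ae_heatSymbol_re_pos hn] with ζ hζ
    have hi := integrable_one_sub_exp_levy hs0 hs1 hζ.le
    rw [lintegral_mul_const _ (by fun_prop)]
    congr 1
    have hir : Integrable (fun τ => 2 * (1 - Complex.exp (-((τ : ℝ) * heatSymbol ζ))).re) (levy s) :=
      hi.re.const_mul 2
    rw [← ofReal_integral_eq_lintegral_ofReal hir]
    · congr 1
      have h3 : ∫ τ, (1 - Complex.exp (-((τ : ℝ) * heatSymbol ζ))).re ∂levy s
        = (∫ τ, (1 - Complex.exp (-((τ : ℝ) * heatSymbol ζ))) ∂levy s).re := integral_re hi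
      have h4 := integral_levy_one_sub_exp hs0 hs1 hζ
      rw [h4, Complex.re_ofReal_mul] at h3
      rw [integral_const_mul, h3]
      ring
    · filter_upwards [ae_levy_pos s] with τ hτ
      simp only [Pi.zero_apply, Complex.sub_re, Complex.one_re]
      have h5 := Complex.re_le_norm (Complex.exp (-(τ * heatSymbol ζ)))
      rw [Complex.norm_exp] at h5
      have h6 : Real.exp (-(τ * heatSymbol ζ) : ℂ).re ≤ 1 := by
        apply Real.exp_le_one_iff.2
        simpa using (mul_pos hτ hζ).le
      linarith

/-! ### Hilbert space structure -/

theorem HSpace.norm_def {n : ℕ} {a : ℝ} (u : HSpace n a) : ‖u‖ = ‖HSpace.weighted n a u‖ := rfl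

instance (n : ℕ) (a : ℝ) : InnerProductSpace ℂ (HSpace n a) where
  inner u v := inner ℂ (HSpace.weighted n a u) (HSpace.weighted n a v)
  norm_sq_eq_re_inner u := by
    rw [HSpace.norm_def]; exact norm_sq_eq_re_inner (𝕜 := ℂ) _
  conj_inner_symm u v := inner_conj_symm _ _
  add_left u v w := by simp only [map_add]; exact inner_add_left _ _ _
  smul_left u v c := by simp only [map_smul]; exact inner_smul_left _ _ _

/-- An element of `𝓗ᵃ` from a square integrable function. -/
def HSpace.mk {n : ℕ} {a : ℝ} (u : L2 n) (hu : u ∈ HSub n a) : HSpace n a := ⟨u, hu⟩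

@[simp]
theorem HSpace.coe_mk {n : ℕ} {a : ℝ} (u : L2 n) (hu : u ∈ HSub n a) :
    (HSpace.mk u hu : L2 n) = u := rfl

theorem coeFn_weighted {n : ℕ} {a : ℝ} (u : HSpace n a) :
    HSpace.weighted n a u =ᵐ[volume] fun ζ => (weight a ζ : ℂ) * (𝓕 (u : L2 n) : L2 n) ζ :=
  MemLp.coeFn_toLp (HSpace.memLp_weighted u)

theorem one_le_weight {n : ℕ} {a : ℝ} (ha : 0 ≤ a) (ζ : SpaceTime n) : 1 ≤ weight a ζ :=
  Real.one_le_rpow (by linarith [norm_nonneg (heatSymbol ζ)]) (by linarith)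

theorem memLp_inv_weight {n : ℕ} {a : ℝ} (ha : 0 ≤ a) :
    MemLp (fun ζ : SpaceTime n => ((weight a ζ : ℂ))⁻¹) ∞ volume := by
  refine memLp_top_of_bound (Measurable.aestronglyMeasurable (by fun_prop)) 1
    (Eventually.of_forall fun ζ => ?_)
  rw [norm_inv, Complex.norm_real, Real.norm_of_nonneg (weight_pos a ζ).le]
  exact inv_le_one_of_one_le₀ (one_le_weight ha ζ)

theorem HSpace.weighted_surjective (n : ℕ) {a : ℝ} (ha : 0 ≤ a) :
    Function.Surjective (HSpace.weighted n a) := by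
  intro g
  set v : L2 n := mulLp (memLp_inv_weight ha) g with hv
  have h0 : (𝓕 (𝓕⁻ v : L2 n) : L2 n) = v :=
    (Lp.fourierTransformₗᵢ (SpaceTime n) ℂ).apply_symm_apply v
  have h1 : (fun ζ => (weight a ζ : ℂ) * (𝓕 (𝓕⁻ v : L2 n) : L2 n) ζ) =ᵐ[volume] g := by
    rw [h0]
    filter_upwards [coeFn_mulLp (memLp_inv_weight ha) g] with ζ hζ
    have hw : (weight a ζ : ℂ) ≠ 0 := by exact_mod_cast (weight_pos a ζ).ne'
    rw [hv, hζ, mul_inv_cancel_left₀ hw]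
  have hmem : (𝓕⁻ v : L2 n) ∈ HSub n a := (memLp_congr_ae h1).2 (Lp.memLp g)
  refine ⟨⟨_, hmem⟩, Lp.ext ?_⟩
  exact (coeFn_weighted _).trans h1

theorem completeSpace_HSpace (n : ℕ) {a : ℝ} (ha : 0 ≤ a) : CompleteSpace (HSpace n a) := by
  let e : HSpace n a ≃ₗᵢ[ℂ] L2 n := LinearIsometryEquiv.ofSurjective
    { HSpace.weighted n a with norm_map' := fun _ => rfl } (HSpace.weighted_surjective n ha)
  exact e.toIsometryEquiv.completeSpace

theorem weight_sq {n : ℕ} (a : ℝ) (ζ : SpaceTime n) :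
    weight a ζ ^ 2 = (1 + ‖heatSymbol ζ‖) ^ a := by
  rw [weight, ← Real.rpow_mul_natCast (by positivity)]
  congr 1
  push_cast; ring

theorem HSpace.enorm_sq {n : ℕ} {a : ℝ} (u : HSpace n a) :
    ‖u‖ₑ ^ 2 = ∫⁻ ζ, ENNReal.ofReal ((1 + ‖heatSymbol ζ‖) ^ a) * ‖(𝓕 (u : L2 n) : L2 n) ζ‖ₑ ^ 2 := by
  have h : ‖u‖ₑ = ‖HSpace.weighted n a u‖ₑ := by
    rw [← ofReal_norm, ← ofReal_norm, HSpace.norm_def]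
  rw [h, enorm_sq_eq_lintegral]
  refine lintegral_congr_ae ?_
  filter_upwards [coeFn_weighted u] with ζ hζ
  rw [hζ, enorm_mul, mul_pow, ← weight_sq, ENNReal.ofReal_pow (weight_pos a ζ).le,
    ← ofReal_norm (weight a ζ : ℂ), Complex.norm_real, Real.norm_of_nonneg (weight_pos a ζ).le]

theorem mem_HSub_of_lintegral_lt_top {n : ℕ} {a : ℝ} {u : L2 n}
    (h : ∫⁻ ζ, ENNReal.ofReal ((1 + ‖heatSymbol ζ‖) ^ a) * ‖(𝓕 u : L2 n) ζ‖ₑ ^ 2 < ∞) :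
    u ∈ HSub n a := by
  refine ⟨AEStronglyMeasurable.mul (Measurable.aestronglyMeasurable (by fun_prop))
    (Lp.aestronglyMeasurable _), ?_⟩
  rw [eLpNorm_lt_top_iff_lintegral_rpow_enorm_lt_top (by norm_num) (by norm_num)]
  refine lt_of_le_of_lt (le_of_eq (lintegral_congr fun ζ => ?_)) h
  simp only [ENNReal.toReal_ofNat, ENNReal.rpow_ofNat]
  rw [enorm_mul, mul_pow, ← weight_sq, ENNReal.ofReal_pow (weight_pos a ζ).le,
    ← ofReal_norm (weight a ζ : ℂ), Complex.norm_real, Real.norm_of_nonneg (weight_pos a ζ).le]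

theorem HSpace.norm_incl_le {n : ℕ} {a : ℝ} (ha : 0 ≤ a) (u : HSpace n a) :
    ‖(u : L2 n)‖ ≤ ‖u‖ := by
  rw [HSpace.norm_def, ← Lp.norm_fourier_eq]
  refine Lp.norm_le_norm_of_ae_le ?_
  filter_upwards [coeFn_weighted u] with ζ hζ
  rw [hζ, norm_mul, Complex.norm_real, Real.norm_of_nonneg (weight_pos a ζ).le]
  exact le_mul_of_one_le_left (norm_nonneg _) (one_le_weight ha ζ)

/-- The inclusion `𝓗ᵃ ⊆ L²` as a bounded map. -/
def HSpace.inclL (n : ℕ) {a : ℝ} (ha : 0 ≤ a) : HSpace n a →L[ℂ] L2 n :=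
  (HSpace.incl n a).mkContinuous 1 fun u => by
    rw [one_mul]; exact HSpace.norm_incl_le ha u

/-! ### The energy characterisation of `𝓗ˢ` -/

/-- The sectoriality constant `cos (π s / 2)`. -/
def sector (s : ℝ) : ℝ := Real.cos (Real.pi / 2 * s)

theorem sector_pos {s : ℝ} (hs0 : 0 < s) (hs1 : s < 1) : 0 < sector s := by
  apply Real.cos_pos_of_mem_Ioo
  constructor <;> nlinarith [Real.pi_pos]

theorem sector_mul_le_re_cpow {s : ℝ} (hs0 : 0 < s) (hs1 : s < 1) {z : ℂ} (hz : 0 ≤ z.re) :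
    sector s * ‖z‖ ^ s ≤ (z ^ (s : ℂ)).re := by
  rw [Complex.cpow_ofReal_re, mul_comm]
  refine mul_le_mul_of_nonneg_left ?_ (Real.rpow_nonneg (norm_nonneg _) _)
  have h := Complex.abs_arg_le_pi_div_two_iff.2 hz
  rw [← Real.cos_abs, abs_mul, abs_of_pos hs0]
  apply Real.cos_le_cos_of_nonneg_of_le_pi
  · positivity
  · nlinarith [Real.pi_pos]
  · gcongr

theorem lintegral_weight_le {n : ℕ} (hn : 1 ≤ n) {s : ℝ} (hs0 : 0 < s) (hs1 : s < 1) (u : L2 n) :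
    ∫⁻ ζ, ENNReal.ofReal ((1 + ‖heatSymbol ζ‖) ^ s) * ‖(𝓕 u : L2 n) ζ‖ₑ ^ 2
      ≤ ‖u‖ₑ ^ 2 + ENNReal.ofReal (2 * levyConst s * sector s)⁻¹ * energy s u := by
  have hc := levyConst_pos hs0 hs1
  have hk := sector_pos hs0 hs1
  have h1 : ‖u‖ₑ = ‖(𝓕 u : L2 n)‖ₑ := by
    rw [← ofReal_norm, ← ofReal_norm, Lp.norm_fourier_eq]
  rw [h1, enorm_sq_eq_lintegral, energy_eq hn hs0 hs1, ← lintegral_const_mul' _ _ (by finiteness),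
    ← lintegral_add_left' ((Lp.aestronglyMeasurable _).enorm.pow_const 2)]
  refine lintegral_mono fun ζ => ?_
  rw [← mul_assoc, ← one_add_mul, ← ENNReal.ofReal_mul (by positivity)]
  gcongr
  rw [← ENNReal.ofReal_one]
  have h2 := sector_mul_le_re_cpow hs0 hs1 (heatSymbol_re_nonneg ζ)
  have h3 : 0 ≤ sector s * ‖heatSymbol ζ‖ ^ s := by positivity
  have h4 : (2 * levyConst s * sector s)⁻¹ * (2 * levyConst s * (heatSymbol ζ ^ (s : ℂ)).re)
      = (heatSymbol ζ ^ (s : ℂ)).re / sector s := by field_simp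
  rw [h4, ← ENNReal.ofReal_add (by norm_num) (div_nonneg (h3.trans h2) hk.le)]
  apply ENNReal.ofReal_le_ofReal
  have h5 : ‖heatSymbol ζ‖ ^ s ≤ (heatSymbol ζ ^ (s : ℂ)).re / sector s := by
    rw [le_div_iff₀ hk, mul_comm]; exact h2
  have h6 := Real.rpow_add_le_add_rpow zero_le_one (norm_nonneg (heatSymbol ζ)) hs0.le hs1.le
  rw [Real.one_rpow] at h6
  linarith

theorem energy_le {n : ℕ} (hn : 1 ≤ n) {s : ℝ} (hs0 : 0 < s) (hs1 : s < 1) (u : HSpace n s) :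
    energy s (u : L2 n) ≤ ENNReal.ofReal (2 * levyConst s) * ‖u‖ₑ ^ 2 := by
  have hc := levyConst_pos hs0 hs1
  rw [HSpace.enorm_sq, energy_eq hn hs0 hs1, ← lintegral_const_mul' _ _ (by finiteness)]
  refine lintegral_mono fun ζ => ?_
  rw [← mul_assoc, ← ENNReal.ofReal_mul (by positivity)]
  gcongr
  refine (Complex.re_le_norm _).trans ?_
  rw [Complex.norm_cpow_real]
  exact Real.rpow_le_rpow (norm_nonneg _) (by linarith [norm_nonneg (heatSymbol ζ)]) hs0.le

/-! ### Multiplication by functions of time -/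

theorem memLp_time {n : ℕ} {φ : ℝ → ℝ} (hm : Measurable φ) {A : ℝ} (hA : ∀ t, |φ t| ≤ A) :
    MemLp (fun z : SpaceTime n => (φ z.fst : ℂ)) ∞ volume :=
  memLp_top_of_bound (Measurable.aestronglyMeasurable (by fun_prop)) A
    (Eventually.of_forall fun z => by simpa using hA z.fst)

/-- The commutator term `∫∫ |φ(t - τ) - φ(t)|² |u|² τ ^ (-1 - s) dτ`. -/
def commEnergy {n : ℕ} (s : ℝ) (φ : ℝ → ℝ) (u : L2 n) : ℝ≥0∞ :=
  ∫⁻ τ, (∫⁻ z, ‖φ (z.fst - τ) - φ z.fst‖ₑ ^ 2 * ‖u z‖ₑ ^ 2) ∂levy s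

theorem enorm_add_sq_le {E : Type*} [SeminormedAddCommGroup E] (x y : E) :
    ‖x + y‖ₑ ^ 2 ≤ 2 * ‖x‖ₑ ^ 2 + 2 * ‖y‖ₑ ^ 2 := by
  rw [← ofReal_norm, ← ofReal_norm, ← ofReal_norm, ← ENNReal.ofReal_pow (norm_nonneg _),
    ← ENNReal.ofReal_pow (norm_nonneg _), ← ENNReal.ofReal_pow (norm_nonneg _),
    ← ENNReal.ofReal_ofNat, ← ENNReal.ofReal_mul (by norm_num), ← ENNReal.ofReal_mul (by norm_num),
    ← ENNReal.ofReal_add (by positivity) (by positivity)]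
  apply ENNReal.ofReal_le_ofReal
  nlinarith [norm_add_le x y, norm_nonneg (x + y), sq_nonneg (‖x‖ - ‖y‖)]

theorem energy_mul_le {n : ℕ} (s : ℝ) {φ : ℝ → ℝ} (hm : Measurable φ) {A : ℝ}
    (hA : ∀ t, |φ t| ≤ A) (u : L2 n) :
    energy s (mulLp (memLp_time hm hA) u)
      ≤ ENNReal.ofReal (2 * A ^ 2) * energy s u + 2 * commEnergy s φ u := by
  have hA0 : 0 ≤ A := (abs_nonneg _).trans (hA 0)
  set v := mulLp (memLp_time (n := n) hm hA) u with hv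
  have key : ∀ τ y, ‖translate (heatShift τ y) v - v‖ₑ ^ 2
      ≤ ENNReal.ofReal (2 * A ^ 2) * ‖translate (heatShift τ y) u - u‖ₑ ^ 2
        + 2 * ∫⁻ z, ‖φ (z.fst - τ) - φ z.fst‖ₑ ^ 2 * ‖u z‖ₑ ^ 2 := by
    intro τ y
    set h : SpaceTime n := heatShift τ y with hh
    rw [enorm_sq_eq_lintegral, enorm_sq_eq_lintegral, ← lintegral_const_mul' _ _ (by finiteness),
      ← lintegral_const_mul' _ _ (by finiteness), ← lintegral_add_left']
    · refine lintegral_mono_ae ?_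
      have h0 := (measurePreserving_sub_right volume h).quasiMeasurePreserving.ae
        (coeFn_mulLp (memLp_time (n := n) hm hA) u)
      filter_upwards [Lp.coeFn_sub (translate h v) v, Lp.coeFn_sub (translate h u) u,
        coeFn_translate h v, coeFn_translate h u, coeFn_mulLp (memLp_time (n := n) hm hA) u, h0]
        with z h1 h2 h3 h4 h5 h6
      have h7 : (z - h).fst = z.fst - τ := rfl
      rw [h1, h2, Pi.sub_apply, Pi.sub_apply, h3, h4, hv, h5, h6, h7]
      have h8 : (φ (z.fst - τ) : ℂ) * u (z - h) - φ z.fst * u z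
          = φ (z.fst - τ) * (u (z - h) - u z) + ((φ (z.fst - τ) - φ z.fst : ℝ) : ℂ) * u z := by
        push_cast; ring
      rw [h8]
      refine (enorm_add_sq_le _ _).trans ?_
      rw [enorm_mul, enorm_mul, mul_pow, mul_pow, ← mul_assoc]
      have h9 : ‖((φ (z.fst - τ) - φ z.fst : ℝ) : ℂ)‖ₑ = ‖φ (z.fst - τ) - φ z.fst‖ₑ := by
        rw [← ofReal_norm, ← ofReal_norm, Complex.norm_real]
      rw [h9]
      gcongr
      rw [← ofReal_norm, Complex.norm_real, ENNReal.ofReal_mul (by norm_num),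
        ENNReal.ofReal_ofNat, ENNReal.ofReal_pow hA0]
      gcongr
      exact hA _
    · exact ((Lp.aestronglyMeasurable _).enorm.pow_const 2).const_mul _
  calc energy s v ≤ ∫⁻ τ, ∫⁻ y, (ENNReal.ofReal (2 * A ^ 2)
        * ‖translate (heatShift τ y) u - u‖ₑ ^ 2
        + 2 * ∫⁻ z, ‖φ (z.fst - τ) - φ z.fst‖ₑ ^ 2 * ‖u z‖ₑ ^ 2) ∂gauss n ∂levy s :=
      lintegral_mono fun τ => lintegral_mono fun y => key τ y
    _ = ENNReal.ofReal (2 * A ^ 2) * energy s u + 2 * commEnergy s φ u := by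
      have hmeas : Measurable fun τ => ∫⁻ z, ‖φ (z.fst - τ) - φ z.fst‖ₑ ^ 2 * ‖u z‖ₑ ^ 2 := by
        have hu : Measurable fun z => ‖u z‖ₑ ^ 2 :=
          (Lp.stronglyMeasurable u).measurable.enorm.pow_const 2
        refine Measurable.lintegral_prod_right' (f := fun q : ℝ × SpaceTime n =>
          ‖φ (q.2.fst - q.1) - φ q.2.fst‖ₑ ^ 2 * ‖u q.2‖ₑ ^ 2) ?_
        exact Measurable.mul (by fun_prop) (hu.comp measurable_snd)
      simp_rw [lintegral_add_right _ measurable_const, lintegral_const_mul' _ _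
        (ENNReal.ofReal_ne_top (r := 2 * A ^ 2)), lintegral_const, measure_univ, mul_one]
      rw [lintegral_add_right _ (hmeas.const_mul 2), lintegral_const_mul' _ _ (by finiteness),
        lintegral_const_mul' _ _ (by finiteness), energy, commEnergy]

theorem norm_mulLp_time_le {n : ℕ} {φ : ℝ → ℝ} (hm : Measurable φ) {A : ℝ}
    (hA : ∀ t, |φ t| ≤ A) (u : L2 n) : ‖mulLp (memLp_time hm hA) u‖ ≤ A * ‖u‖ := by
  refine Lp.norm_le_mul_norm_of_ae_le_mul ?_
  filter_upwards [coeFn_mulLp (memLp_time (n := n) hm hA) u] with z hz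
  rw [hz, norm_mul, Complex.norm_real]
  gcongr
  exact hA _

/-- A bounded function of time whose commutator with translations is controlled by the `𝓗ˢ` norm is
a multiplier of `𝓗ˢ`. -/
theorem exists_mul_HSpace {n : ℕ} (hn : 1 ≤ n) {s : ℝ} (hs0 : 0 < s) (hs1 : s < 1) {φ : ℝ → ℝ}
    (hm : Measurable φ) {A : ℝ} (hA : ∀ t, |φ t| ≤ A) {C : ℝ} (hC0 : 0 ≤ C)
    (hC : ∀ u : HSpace n s, commEnergy s φ (u : L2 n) ≤ ENNReal.ofReal C * ‖u‖ₑ ^ 2) :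
    ∃ M : HSpace n s →L[ℂ] HSpace n s, ∀ u,
      ((M u : L2 n) : SpaceTime n → ℂ) =ᵐ[volume] fun z => φ z.fst * (u : L2 n) z := by
  have hA0 : 0 ≤ A := (abs_nonneg _).trans (hA 0)
  have hc := levyConst_pos hs0 hs1
  have hk := sector_pos hs0 hs1
  set D : ℝ := A ^ 2 + (2 * levyConst s * sector s)⁻¹
    * (2 * A ^ 2 * (2 * levyConst s) + 2 * C) with hD
  have hD0 : 0 ≤ D := by positivity
  have hbound : ∀ u : HSpace n s, ∫⁻ ζ, ENNReal.ofReal ((1 + ‖heatSymbol ζ‖) ^ s)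
      * ‖(𝓕 (mulLp (memLp_time (n := n) hm hA) (u : L2 n)) : L2 n) ζ‖ₑ ^ 2
        ≤ ENNReal.ofReal D * ‖u‖ₑ ^ 2 := by
    intro u
    refine (lintegral_weight_le hn hs0 hs1 _).trans ?_
    have h1 := energy_mul_le s hm hA (u : L2 n)
    have h2 := energy_le hn hs0 hs1 u
    have h3 : ‖mulLp (memLp_time (n := n) hm hA) (u : L2 n)‖ₑ ^ 2
        ≤ ENNReal.ofReal (A ^ 2) * ‖u‖ₑ ^ 2 := by
      rw [← ofReal_norm, ← ofReal_norm, ENNReal.ofReal_pow hA0, ← mul_pow,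
        ← ENNReal.ofReal_mul hA0]
      gcongr
      exact (norm_mulLp_time_le hm hA _).trans (by gcongr; exact HSpace.norm_incl_le hs0.le u)
    calc _ ≤ ENNReal.ofReal (A ^ 2) * ‖u‖ₑ ^ 2 + ENNReal.ofReal (2 * levyConst s * sector s)⁻¹
        * (ENNReal.ofReal (2 * A ^ 2) * (ENNReal.ofReal (2 * levyConst s) * ‖u‖ₑ ^ 2)
          + 2 * (ENNReal.ofReal C * ‖u‖ₑ ^ 2)) := by
          gcongr
          exact h1.trans (by gcongr; exact hC u)
      _ = ENNReal.ofReal D * ‖u‖ₑ ^ 2 := by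
        rw [hD, ENNReal.ofReal_add (by positivity) (by positivity),
          ENNReal.ofReal_mul (p := (2 * levyConst s * sector s)⁻¹) (by positivity),
          ENNReal.ofReal_add (by positivity) (by positivity),
          ENNReal.ofReal_mul (p := 2 * A ^ 2) (by positivity),
          ENNReal.ofReal_mul (p := 2) (q := C) (by positivity), ENNReal.ofReal_ofNat]
        ring
  have hmem : ∀ u : HSpace n s, mulLp (memLp_time (n := n) hm hA) (u : L2 n) ∈ HSub n s :=
    fun u => mem_HSub_of_lintegral_lt_top ((hbound u).trans_lt (by
      exact ENNReal.mul_lt_top ENNReal.ofReal_lt_top (ENNReal.pow_lt_top enorm_lt_top)))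
  let M : HSpace n s →ₗ[ℂ] HSpace n s :=
    { toFun := fun u => HSpace.mk (mulLp (memLp_time (n := n) hm hA) (u : L2 n)) (hmem u)
      map_add' := fun u v => HSpace.incl_injective n s (by simp only [map_add, HSpace.coe_mk])
      map_smul' := fun c u => HSpace.incl_injective n s (by
        simp only [map_smul, HSpace.coe_mk, RingHom.id_apply]) }
  refine ⟨M.mkContinuous (√D) fun u => ?_, fun u => coeFn_mulLp (memLp_time (n := n) hm hA) u⟩
  have h1 : ‖M u‖ₑ ^ 2 ≤ ENNReal.ofReal D * ‖u‖ₑ ^ 2 := (HSpace.enorm_sq (M u)).trans_le (hbound u)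
  rw [← ofReal_norm, ← ofReal_norm, ← ENNReal.ofReal_pow (norm_nonneg _),
    ← ENNReal.ofReal_pow (norm_nonneg _), ← ENNReal.ofReal_mul hD0,
    ENNReal.ofReal_le_ofReal_iff (by positivity)] at h1
  refine le_of_sq_le_sq ?_ (by positivity)
  rwa [mul_pow, Real.sq_sqrt hD0]

theorem enorm_incl_le {n : ℕ} {a : ℝ} (ha : 0 ≤ a) (u : HSpace n a) :
    ‖(u : L2 n)‖ₑ ≤ ‖u‖ₑ := by
  rw [← ofReal_norm, ← ofReal_norm]
  exact ENNReal.ofReal_le_ofReal (HSpace.norm_incl_le ha u)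

theorem exists_mul_HSpace_of_lipschitz {n : ℕ} (hn : 1 ≤ n) {s : ℝ} (hs0 : 0 < s) (hs1 : s < 1)
    {φ : ℝ → ℝ} (hm : Measurable φ) {A L : ℝ} (hA : ∀ t, |φ t| ≤ A)
    (hL : ∀ t t', |φ t - φ t'| ≤ L * |t - t'|) :
    ∃ M : HSpace n s →L[ℂ] HSpace n s, ∀ u,
      ((M u : L2 n) : SpaceTime n → ℂ) =ᵐ[volume] fun z => φ z.fst * (u : L2 n) z := by
  set D : ℝ := max (2 * A) L with hD
  have hA0 : 0 ≤ A := (abs_nonneg _).trans (hA 0)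
  have hD0 : 0 ≤ D := le_max_of_le_left (by positivity)
  have hpt : ∀ t τ : ℝ, 0 < τ → |φ (t - τ) - φ t| ^ 2 ≤ D ^ 2 * min 1 τ := by
    intro t τ hτ
    have h1 : |φ (t - τ) - φ t| ≤ D * min 1 τ := by
      rcases le_total 1 τ with h | h
      · rw [min_eq_left h, mul_one]
        calc |φ (t - τ) - φ t| ≤ |φ (t - τ)| + |φ t| := abs_sub _ _
          _ ≤ 2 * A := by linarith [hA (t - τ), hA t]
          _ ≤ D := le_max_left _ _
      · rw [min_eq_right h]
        refine (hL _ _).trans ?_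
        rw [show t - τ - t = -τ by ring, abs_neg, abs_of_pos hτ]
        gcongr
        exact le_max_right _ _
    have h2 : 0 ≤ min 1 τ := by positivity
    calc |φ (t - τ) - φ t| ^ 2 ≤ (D * min 1 τ) ^ 2 := by gcongr
      _ = D ^ 2 * (min 1 τ * min 1 τ) := by ring
      _ ≤ D ^ 2 * (1 * min 1 τ) := by gcongr; exact min_le_left _ _
      _ = D ^ 2 * min 1 τ := by ring
  have hint := integrable_min_levy hs0 hs1
  have hnn : 0 ≤ᵐ[levy s] fun τ => D ^ 2 * min 1 τ := by
    filter_upwards [ae_levy_pos s] with τ hτ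
    simp only [Pi.zero_apply]; positivity
  refine exists_mul_HSpace hn hs0 hs1 hm hA (C := ∫ τ, D ^ 2 * min 1 τ ∂levy s)
    (integral_nonneg_of_ae hnn) fun u => ?_
  calc commEnergy s φ (u : L2 n)
      ≤ ∫⁻ τ, ENNReal.ofReal (D ^ 2 * min 1 τ) * ‖(u : L2 n)‖ₑ ^ 2 ∂levy s := by
        refine lintegral_mono_ae ?_
        filter_upwards [ae_levy_pos s] with τ hτ
        rw [enorm_sq_eq_lintegral, ← lintegral_const_mul' _ _ (by finiteness)]
        refine lintegral_mono fun z => ?_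
        gcongr
        rw [← ofReal_norm, ← ENNReal.ofReal_pow (norm_nonneg _)]
        exact ENNReal.ofReal_le_ofReal (hpt _ _ hτ)
    _ = ENNReal.ofReal (∫ τ, D ^ 2 * min 1 τ ∂levy s) * ‖(u : L2 n)‖ₑ ^ 2 := by
        rw [lintegral_mul_const' _ _ (by finiteness),
          ofReal_integral_eq_lintegral_ofReal (hint.const_mul _) hnn]
    _ ≤ _ := by gcongr; exact enorm_incl_le hs0.le u

/-! ### A fractional Hardy inequality in time -/

/-- The mass `∫ |u|²` over the time slab `a ≤ t < a + r`. -/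
def slabMass {n : ℕ} (u : L2 n) (a r : ℝ) : ℝ≥0∞ :=
  ∫⁻ z in {z : SpaceTime n | z.fst ∈ Ico a (a + r)}, ‖u z‖ₑ ^ 2

theorem measurableSet_slab {n : ℕ} (a b : ℝ) :
    MeasurableSet {z : SpaceTime n | z.fst ∈ Ico a b} :=
  measurable_fst_spaceTime measurableSet_Ico

theorem slabMass_le {n : ℕ} (u : L2 n) (a r : ℝ) : slabMass u a r ≤ ‖u‖ₑ ^ 2 := by
  rw [enorm_sq_eq_lintegral]; exact setLIntegral_le_lintegral _ _

theorem slabMass_mono {n : ℕ} (u : L2 n) (a : ℝ) : Monotone (slabMass u a) := fun r r' h =>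
  lintegral_mono_set fun z hz => ⟨hz.1, hz.2.trans_le (by linarith)⟩

theorem slabMass_two_mul {n : ℕ} (u : L2 n) (a r : ℝ) :
    slabMass u a (2 * r) = slabMass u a r + slabMass u (a + r) r := by
  rw [slabMass, slabMass, slabMass, ← lintegral_union (measurableSet_slab _ _)]
  · congr 2
    ext z
    simp only [mem_ofPred_eq, mem_union, mem_Ico]
    constructor
    · rintro ⟨h1, h2⟩
      rcases lt_or_ge z.fst (a + r) with h | h
      · exact Or.inl ⟨h1, h⟩
      · exact Or.inr ⟨h, by linarith⟩
    · rintro (⟨h1, h2⟩ | ⟨h1, h2⟩)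
      · exact ⟨h1, by linarith⟩
      · exact ⟨by linarith, by linarith⟩
  · rw [Set.disjoint_left]
    intro z h1 h2
    exact absurd h1.2 (not_lt.2 h2.1)

theorem enorm_add_sq_le_weighted {E : Type*} [SeminormedAddCommGroup E] (x y : E) {ε : ℝ}
    (hε : 0 < ε) :
    ‖x + y‖ₑ ^ 2 ≤ ENNReal.ofReal (1 + ε⁻¹) * ‖x‖ₑ ^ 2 + ENNReal.ofReal (1 + ε) * ‖y‖ₑ ^ 2 := by
  rw [← ofReal_norm, ← ofReal_norm, ← ofReal_norm, ← ENNReal.ofReal_pow (norm_nonneg _),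
    ← ENNReal.ofReal_pow (norm_nonneg _), ← ENNReal.ofReal_pow (norm_nonneg _),
    ← ENNReal.ofReal_mul (by positivity), ← ENNReal.ofReal_mul (by positivity),
    ← ENNReal.ofReal_add (by positivity) (by positivity)]
  apply ENNReal.ofReal_le_ofReal
  have h1 : ‖x + y‖ ^ 2 ≤ (‖x‖ + ‖y‖) ^ 2 := by gcongr; exact norm_add_le x y
  have h2 : 2 * ‖x‖ * ‖y‖ ≤ ε⁻¹ * ‖x‖ ^ 2 + ε * ‖y‖ ^ 2 := by
    have h3 : 0 ≤ ε⁻¹ * (‖x‖ - ε * ‖y‖) ^ 2 := by positivity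
    have h4 : ε⁻¹ * (‖x‖ - ε * ‖y‖) ^ 2 = ε⁻¹ * ‖x‖ ^ 2 - 2 * ‖x‖ * ‖y‖ + ε * ‖y‖ ^ 2 := by
      field_simp; ring
    linarith
  nlinarith

theorem slabMass_shift_le {n : ℕ} (u : L2 n) (a : ℝ) {r : ℝ} (y : EuclideanSpace ℝ (Fin n))
    {ε : ℝ} (hε : 0 < ε) :
    slabMass u a r ≤ ENNReal.ofReal (1 + ε⁻¹) * ‖translate (heatShift r y) u - u‖ₑ ^ 2
      + ENNReal.ofReal (1 + ε) * slabMass u (a + r) r := by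
  set h : SpaceTime n := heatShift r y with hh
  have h1 : slabMass u a r = slabMass (translate h u) (a + r) r := by
    have hp := measurePreserving_sub_right (volume : Measure (SpaceTime n)) h
    rw [slabMass, slabMass,
      ← hp.setLIntegral_comp_preimage_emb (MeasurableEquiv.subRight h).measurableEmbedding]
    have hset : (fun z : SpaceTime n => z - h) ⁻¹' {z | z.fst ∈ Ico a (a + r)}
        = {z | z.fst ∈ Ico (a + r) (a + r + r)} := by
      ext z
      have h7 : (z - h).fst = z.fst - r := rfl
      simp only [mem_preimage, mem_ofPred_eq, h7, mem_Ico]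
      constructor <;> rintro ⟨h1, h2⟩ <;> constructor <;> linarith
    rw [hset]
    refine lintegral_congr_ae (ae_restrict_of_ae ?_)
    filter_upwards [coeFn_translate h u] with z hz
    rw [hz]
  rw [h1, slabMass, slabMass, enorm_sq_eq_lintegral]
  calc _ ≤ ∫⁻ z in {z : SpaceTime n | z.fst ∈ Ico (a + r) (a + r + r)},
        (ENNReal.ofReal (1 + ε⁻¹) * ‖(translate h u - u : L2 n) z‖ₑ ^ 2
          + ENNReal.ofReal (1 + ε) * ‖u z‖ₑ ^ 2) := by
        refine lintegral_mono_ae (ae_restrict_of_ae ?_)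
        filter_upwards [Lp.coeFn_sub (translate h u) u] with z hz
        refine le_trans (le_of_eq ?_) (enorm_add_sq_le_weighted _ _ hε)
        rw [hz, Pi.sub_apply, sub_add_cancel]
    _ ≤ _ := by
        rw [lintegral_add_left' (((Lp.aestronglyMeasurable _).restrict.enorm.pow_const 2).const_mul _),
          lintegral_const_mul' _ _ (by finiteness), lintegral_const_mul' _ _ (by finiteness)]
        gcongr
        exact Measure.restrict_le_self

/-- The Hardy inequality `∫ (t - a)₊ ^ (-s) |u|² ≤ C ‖u‖²`, valid because `s < 1`, in the
integrated form with slab masses. Shifting the slab `[a, a + r)` onto `[a + r, a + 2r)` bounds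
the mass of the former by the energy and the mass of the latter; integration in `r` then absorbs the
mass term, as `(1 + ε) 2 ^ s < 2 + ε` for `ε = 2 - 2 ^ s`. -/
theorem lintegral_slabMass_le {n : ℕ} {s : ℝ} (hs0 : 0 < s) (hs1 : s < 1)
    (u : L2 n) (a : ℝ) :
    ∫⁻ r, slabMass u a r ∂levy s
      ≤ ENNReal.ofReal ((2 - 2 ^ s) ^ 2)⁻¹ * ENNReal.ofReal (1 + (2 - 2 ^ s)⁻¹) * energy s u := by
  set ε : ℝ := 2 - 2 ^ s with hεdef
  have hε : 0 < ε := by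
    have : (2 : ℝ) ^ s < 2 ^ (1 : ℝ) := Real.rpow_lt_rpow_of_exponent_lt (by norm_num) hs1
    rw [Real.rpow_one] at this
    linarith
  have hmeas : Measurable (slabMass u a) := (slabMass_mono u a).measurable
  have hstep : ∀ r, 0 < r → ENNReal.ofReal (2 + ε) * slabMass u a r
      ≤ ENNReal.ofReal (1 + ε⁻¹) * ∫⁻ y, ‖translate (heatShift r y) u - u‖ₑ ^ 2 ∂gauss n
        + ENNReal.ofReal (1 + ε) * slabMass u a (2 * r) := by
    intro r hr
    have h1 : slabMass u a r
        ≤ ENNReal.ofReal (1 + ε⁻¹) * ∫⁻ y, ‖translate (heatShift r y) u - u‖ₑ ^ 2 ∂gauss n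
          + ENNReal.ofReal (1 + ε) * slabMass u (a + r) r := by
      calc slabMass u a r = ∫⁻ _y, slabMass u a r ∂gauss n := by simp
        _ ≤ ∫⁻ y, (ENNReal.ofReal (1 + ε⁻¹) * ‖translate (heatShift r y) u - u‖ₑ ^ 2
            + ENNReal.ofReal (1 + ε) * slabMass u (a + r) r) ∂gauss n :=
          lintegral_mono fun y => slabMass_shift_le u a y hε
        _ = _ := by
          rw [lintegral_add_right _ measurable_const, lintegral_const_mul' _ _ (by finiteness)]
          simp
    rw [slabMass_two_mul u a r, show 2 + ε = 1 + (1 + ε) by ring,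
      ENNReal.ofReal_add (by norm_num) (by positivity), ENNReal.ofReal_one, add_mul, one_mul,
      mul_add]
    calc _ ≤ _ := add_le_add_left h1 _
      _ = _ := by ring
  have hδ : ∀ δ : ℝ, 0 < δ → ∫⁻ r in Ioi δ, slabMass u a r ∂levy s
      ≤ ENNReal.ofReal (ε ^ 2)⁻¹ * ENNReal.ofReal (1 + ε⁻¹) * energy s u := by
    intro δ hδ
    set J := ∫⁻ r in Ioi δ, slabMass u a r ∂levy s with hJ
    have hJfin : J < ∞ := by
      calc J ≤ ∫⁻ _r in Ioi δ, ‖u‖ₑ ^ 2 ∂levy s := lintegral_mono fun r => slabMass_le u a r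
        _ = ‖u‖ₑ ^ 2 * levy s (Ioi δ) := setLIntegral_const _ _
        _ < ∞ := ENNReal.mul_lt_top (ENNReal.pow_lt_top enorm_lt_top) (levy_Ioi_lt_top hs0 hδ)
    have hscale : ∫⁻ r in Ioi δ, slabMass u a (2 * r) ∂levy s ≤ ENNReal.ofReal (2 ^ s) * J := by
      rw [hJ, ← lintegral_indicator measurableSet_Ioi, ← lintegral_indicator measurableSet_Ioi,
        ← lintegral_levy_comp_mul s two_pos (hmeas.indicator measurableSet_Ioi)]
      refine lintegral_mono fun r => ?_
      by_cases hr : δ < r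
      · rw [indicator_of_mem (mem_Ioi.2 hr), indicator_of_mem (by simp only [mem_Ioi]; linarith)]
      · rw [indicator_of_notMem (by simpa using hr)]
        exact zero_le
    have hI : ENNReal.ofReal (2 + ε) * J ≤ ENNReal.ofReal (1 + ε⁻¹) * energy s u
        + ENNReal.ofReal (1 + ε) * (ENNReal.ofReal (2 ^ s) * J) := by
      calc ENNReal.ofReal (2 + ε) * J
          = ∫⁻ r in Ioi δ, ENNReal.ofReal (2 + ε) * slabMass u a r ∂levy s := by
            rw [lintegral_const_mul' _ _ (by finiteness)]
        _ ≤ ∫⁻ r in Ioi δ, (ENNReal.ofReal (1 + ε⁻¹)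
            * ∫⁻ y, ‖translate (heatShift r y) u - u‖ₑ ^ 2 ∂gauss n
            + ENNReal.ofReal (1 + ε) * slabMass u a (2 * r)) ∂levy s := by
            refine setLIntegral_mono' measurableSet_Ioi fun r hr => hstep r (hδ.trans hr)
        _ = ENNReal.ofReal (1 + ε⁻¹)
            * (∫⁻ r in Ioi δ, ∫⁻ y, ‖translate (heatShift r y) u - u‖ₑ ^ 2 ∂gauss n ∂levy s)
            + ENNReal.ofReal (1 + ε) * ∫⁻ r in Ioi δ, slabMass u a (2 * r) ∂levy s := by
            have hm2 : Measurable fun r => slabMass u a (2 * r) := by fun_prop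
            rw [lintegral_add_right _ (hm2.const_mul _),
              lintegral_const_mul' _ _ (by finiteness), lintegral_const_mul' _ _ (by finiteness)]
        _ ≤ _ := by
            gcongr
            exact setLIntegral_le_lintegral _ _
    have hsplit : ENNReal.ofReal (2 + ε) * J = ENNReal.ofReal (ε ^ 2) * J
        + ENNReal.ofReal (1 + ε) * (ENNReal.ofReal (2 ^ s) * J) := by
      rw [← mul_assoc, ← ENNReal.ofReal_mul (by positivity), ← add_mul,
        ← ENNReal.ofReal_add (by positivity) (by positivity)]
      congr 2
      rw [hεdef]; ring
    rw [hsplit] at hI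
    have hI2 : ENNReal.ofReal (ε ^ 2) * J ≤ ENNReal.ofReal (1 + ε⁻¹) * energy s u :=
      (ENNReal.add_le_add_iff_right (by finiteness)).1 hI
    have hε2 : 0 < ε ^ 2 := by positivity
    calc J = ENNReal.ofReal (ε ^ 2)⁻¹ * (ENNReal.ofReal (ε ^ 2) * J) := by
          rw [← mul_assoc, ← ENNReal.ofReal_mul (by positivity), inv_mul_cancel₀ hε2.ne',
            ENNReal.ofReal_one, one_mul]
      _ ≤ _ := by rw [mul_assoc]; gcongr
  have hU : (⋃ k : ℕ, Ioi (1 / ((k : ℝ) + 1))) = Ioi (0 : ℝ) := by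
    ext r
    simp only [mem_iUnion, mem_Ioi]
    constructor
    · rintro ⟨k, hk⟩
      exact (by positivity : (0 : ℝ) < 1 / ((k : ℝ) + 1)).trans hk
    · exact fun hr => exists_nat_one_div_lt hr
  have hpos : levy s = (levy s).restrict (Ioi 0) :=
    (Measure.restrict_eq_self_of_ae_mem (ae_levy_pos s)).symm
  rw [hpos, ← hU, setLIntegral_iUnion_of_directed]
  · exact iSup_le fun k => hδ _ (by positivity)
  · refine Monotone.directed_le fun k l hkl => Ioi_subset_Ioi ?_
    exact one_div_le_one_div_of_le (by positivity) (by gcongr)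

/-- The cut-off in time is bounded on `𝓗ˢ`. -/
theorem exists_timeCut_HSpace {n : ℕ} (hn : 1 ≤ n) {s : ℝ} (hs0 : 0 < s) (hs1 : s < 1) (T : ℝ) :
    ∃ M : HSpace n s →L[ℂ] HSpace n s, ∀ u,
      ((M u : L2 n) : SpaceTime n → ℂ) =ᵐ[volume] timeCut T (u : L2 n) := by
  set φ : ℝ → ℝ := (Ico (-T) T).indicator 1 with hφ
  have hφm : Measurable φ := measurable_one.indicator measurableSet_Ico
  have hφ1 : ∀ t, |φ t| ≤ 1 := by
    intro t
    by_cases ht : t ∈ Ico (-T) T <;> simp [hφ, ht]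
  set C₀ : ℝ := ((2 - 2 ^ s) ^ 2)⁻¹ * (1 + (2 - 2 ^ s)⁻¹) * (2 * levyConst s) with hC₀
  have hc := levyConst_pos hs0 hs1
  have hε : 0 < 2 - (2 : ℝ) ^ s := by
    have : (2 : ℝ) ^ s < 2 ^ (1 : ℝ) := Real.rpow_lt_rpow_of_exponent_lt (by norm_num) hs1
    rw [Real.rpow_one] at this
    linarith
  have hhardy : ∀ (u : HSpace n s) (a : ℝ), ∫⁻ r, slabMass (u : L2 n) a r ∂levy s
      ≤ ENNReal.ofReal C₀ * ‖u‖ₑ ^ 2 := by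
    intro u a
    refine (lintegral_slabMass_le hs0 hs1 _ a).trans ?_
    rw [hC₀, ENNReal.ofReal_mul (by positivity), ENNReal.ofReal_mul (by positivity),
      mul_assoc (ENNReal.ofReal _ * ENNReal.ofReal _)]
    gcongr
    exact energy_le hn hs0 hs1 u
  obtain ⟨M, hM⟩ := exists_mul_HSpace hn hs0 hs1 hφm hφ1 (C := C₀ + C₀) (by positivity) (by
    intro u
    calc commEnergy s φ (u : L2 n)
        ≤ ∫⁻ τ, (slabMass (u : L2 n) (-T) τ + slabMass (u : L2 n) T τ) ∂levy s := by
          refine lintegral_mono_ae ?_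
          filter_upwards [ae_levy_pos s] with τ hτ
          rw [slabMass, slabMass, ← lintegral_indicator (measurableSet_slab _ _),
            ← lintegral_indicator (measurableSet_slab _ _), ← lintegral_add_left']
          · refine lintegral_mono fun z => ?_
            simp only [indicator, mem_ofPred_eq]
            simp only [hφ, indicator, Pi.one_apply, mem_Ico]
            split_ifs <;> first | (exfalso; grind) | simp
          · exact ((Lp.aestronglyMeasurable _).enorm.pow_const 2).indicator (measurableSet_slab _ _)
      _ = ∫⁻ τ, slabMass (u : L2 n) (-T) τ ∂levy s + ∫⁻ τ, slabMass (u : L2 n) T τ ∂levy s :=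
          lintegral_add_left (slabMass_mono _ _).measurable _
      _ ≤ ENNReal.ofReal C₀ * ‖u‖ₑ ^ 2 + ENNReal.ofReal C₀ * ‖u‖ₑ ^ 2 :=
          add_le_add (hhardy u _) (hhardy u _)
      _ = ENNReal.ofReal (C₀ + C₀) * ‖u‖ₑ ^ 2 := by
          rw [ENNReal.ofReal_add (by positivity) (by positivity), add_mul])
  refine ⟨M, fun u => ?_⟩
  filter_upwards [hM u, ae_fst_ne (n := n) T] with z h1 h2
  rw [h1, timeCut]
  by_cases hz : z.fst ∈ Ico (-T) T
  · rw [indicator_of_mem (show z ∈ {z : SpaceTime n | z.fst ∈ Icc (-T) T} from ⟨hz.1, hz.2.le⟩)]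
    simp [hφ, hz]
  · rw [indicator_of_notMem (show z ∉ {z : SpaceTime n | z.fst ∈ Icc (-T) T} from
      fun h => hz ⟨h.1, lt_of_le_of_ne h.2 h2⟩)]
    simp [hφ, hz]

/-! ### The form of the fractional heat operator -/

/-- The form `∫ (iρ + |ξ|²) ^ s û conj ŵ`, which is `(𝓛^{s/2} u, 𝓛^{s/2}_* w)`. -/
def mainForm {n : ℕ} (s : ℝ) (u w : L2 n) : ℂ :=
  ∫ ζ, heatSymbol ζ ^ (s : ℂ) * ((𝓕 u : L2 n) ζ * conj ((𝓕 w : L2 n) ζ))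

theorem memLp_symbol_mul {n : ℕ} {s : ℝ} (hs0 : 0 < s) (u : HSpace n s)
    {S : SpaceTime n → ℂ} (hS : Measurable S) (hb : ∀ ζ, ‖S ζ‖ = ‖heatSymbol ζ‖) :
    MemLp (fun ζ => S ζ ^ ((s / 2 : ℝ) : ℂ) * (𝓕 (u : L2 n) : L2 n) ζ) 2 volume := by
  refine (HSpace.memLp_weighted u).of_le
    (AEStronglyMeasurable.mul (Measurable.aestronglyMeasurable (by fun_prop))
      (Lp.aestronglyMeasurable _)) (Eventually.of_forall fun ζ => ?_)
  rw [norm_mul, norm_mul, Complex.norm_cpow_real, hb, Complex.norm_real,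
    Real.norm_of_nonneg (weight_pos s ζ).le]
  gcongr
  exact Real.rpow_le_rpow (norm_nonneg _) (by linarith [norm_nonneg (heatSymbol ζ)]) (by positivity)

theorem fourier_fourierInv_L2 {n : ℕ} (v : L2 n) : (𝓕 (𝓕⁻ v : L2 n) : L2 n) = v :=
  (Lp.fourierTransformₗᵢ (SpaceTime n) ℂ).apply_symm_apply v

theorem pairing_univ_eq_inner {n : ℕ} (u w : L2 n) : pairing univ u w = inner ℂ w u := by
  rw [pairing, Measure.restrict_univ, L2.inner_def]
  refine integral_congr_ae (Eventually.of_forall fun z => ?_)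
  simp only [RCLike.inner_apply]

theorem conj_cpow_half_mul {s : ℝ} {z : ℂ} (hz : 0 ≤ z.re) (hs0 : 0 < s) :
    z ^ ((s / 2 : ℝ) : ℂ) * conj (conj z ^ ((s / 2 : ℝ) : ℂ)) = z ^ (s : ℂ) := by
  rcases eq_or_ne z 0 with rfl | hz0
  · have h1 : (s : ℂ) ≠ 0 := by exact_mod_cast hs0.ne'
    have h2 : ((s / 2 : ℝ) : ℂ) ≠ 0 := by exact_mod_cast (half_pos hs0).ne'
    rw [Complex.zero_cpow h1, Complex.zero_cpow h2, zero_mul]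
  have harg : z.arg ≠ Real.pi := by
    intro h
    have := Complex.abs_arg_le_pi_div_two_iff.2 hz
    rw [h, abs_of_pos Real.pi_pos] at this
    linarith [Real.pi_pos]
  rw [Complex.conj_cpow _ _ harg, Complex.conj_conj, Complex.conj_ofReal, ← Complex.cpow_add _ _ hz0]
  congr 1
  push_cast; ring

theorem pairing_fracHeat {n : ℕ} {s : ℝ} (hs0 : 0 < s) (u w : HSpace n s) :
    pairing univ (fracHeat (s / 2) (u : L2 n)) (fracHeatAdj (s / 2) (w : L2 n))
      = mainForm s (u : L2 n) (w : L2 n) := by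
  have hu := memLp_symbol_mul hs0 u measurable_heatSymbol fun _ => rfl
  have hw := memLp_symbol_mul hs0 w (S := fun ζ => conj (heatSymbol ζ)) (by fun_prop)
    fun ζ => RCLike.norm_conj _
  rw [pairing_univ_eq_inner, fracHeat, dif_pos hu, fracHeatAdj, dif_pos hw, ← Lp.inner_fourier_eq,
    fourier_fourierInv_L2, fourier_fourierInv_L2, L2.inner_def, mainForm]
  refine integral_congr_ae ?_
  filter_upwards [hu.coeFn_toLp, hw.coeFn_toLp] with ζ h1 h2
  rw [h1, h2, RCLike.inner_apply, map_mul, ← conj_cpow_half_mul (heatSymbol_re_nonneg ζ) hs0]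
  ring

theorem norm_cpow_le_weight_sq {n : ℕ} {s : ℝ} (hs0 : 0 < s) (ζ : SpaceTime n) :
    ‖heatSymbol ζ ^ (s : ℂ)‖ ≤ weight s ζ ^ 2 := by
  rw [weight_sq, Complex.norm_cpow_real]
  exact Real.rpow_le_rpow (norm_nonneg _) (by linarith [norm_nonneg (heatSymbol ζ)]) hs0.le

/-- The symbol `(iρ + |ξ|²) ^ s` normalised by the squared weight. -/
def normSymbol {n : ℕ} (s : ℝ) (ζ : SpaceTime n) : ℂ :=
  heatSymbol ζ ^ (s : ℂ) / ((weight s ζ ^ 2 : ℝ) : ℂ)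

theorem memLp_normSymbol {n : ℕ} {s : ℝ} (hs0 : 0 < s) :
    MemLp (normSymbol s : SpaceTime n → ℂ) ∞ volume := by
  refine memLp_top_of_bound (Measurable.aestronglyMeasurable (by unfold normSymbol; fun_prop)) 1
    (Eventually.of_forall fun ζ => ?_)
  have hw : 0 < weight s ζ ^ 2 := pow_pos (weight_pos s ζ) 2
  rw [normSymbol, norm_div, Complex.norm_real, Real.norm_of_nonneg hw.le, div_le_one hw]
  exact norm_cpow_le_weight_sq hs0 ζ

/-- The map `u ↦ (1 + |iρ + |ξ|²|) ^ (a / 2) û` as a linear isometry. -/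
def HSpace.weightedₗᵢ (n : ℕ) (a : ℝ) : HSpace n a →ₗᵢ[ℂ] L2 n :=
  { HSpace.weighted n a with norm_map' := fun _ => rfl }

theorem mainForm_eq_inner {n : ℕ} {s : ℝ} (hs0 : 0 < s) (u w : HSpace n s) :
    mainForm s (u : L2 n) (w : L2 n) = inner ℂ (HSpace.weightedₗᵢ n s w)
      (mulLp (memLp_normSymbol hs0) (HSpace.weightedₗᵢ n s u)) := by
  rw [L2.inner_def, mainForm]
  refine integral_congr_ae ?_
  filter_upwards [coeFn_weighted u, coeFn_weighted w,
    coeFn_mulLp (memLp_normSymbol hs0) (HSpace.weightedₗᵢ n s u)] with ζ h1 h2 h3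
  have h1' : (HSpace.weightedₗᵢ n s u) ζ = (weight s ζ : ℂ) * (𝓕 (u : L2 n) : L2 n) ζ := h1
  have h2' : (HSpace.weightedₗᵢ n s w) ζ = (weight s ζ : ℂ) * (𝓕 (w : L2 n) : L2 n) ζ := h2
  have hw : (weight s ζ : ℂ) ≠ 0 := by exact_mod_cast (weight_pos s ζ).ne'
  rw [h3, h1', h2', RCLike.inner_apply, map_mul, Complex.conj_ofReal, normSymbol]
  push_cast
  field_simp

/-! ### Subordination to the heat flow -/

/-- The pairing of `u`, transported by the heat flow for time `τ`, with `w`. -/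
def heatPairing {n : ℕ} (τ : ℝ) (u w : L2 n) : ℂ :=
  ∫ y, inner ℂ w (translate (heatShift τ y) u) ∂gauss n

theorem integrable_mul_conj {n : ℕ} (f g : L2 n) :
    Integrable (fun ζ => f ζ * conj (g ζ)) volume := by
  have h := L2.integrable_inner (𝕜 := ℂ) g f
  refine h.congr (Eventually.of_forall fun ζ => ?_)
  simp only [RCLike.inner_apply]

theorem heatPairing_eq {n : ℕ} {τ : ℝ} (hτ : 0 ≤ τ) (u w : L2 n) :
    heatPairing τ u w
      = ∫ ζ, Complex.exp (-(τ * heatSymbol ζ)) * ((𝓕 u : L2 n) ζ * conj ((𝓕 w : L2 n) ζ)) := by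
  have hG := integrable_mul_conj (𝓕 u : L2 n) (𝓕 w)
  have hph : AEStronglyMeasurable (fun q : EuclideanSpace ℝ (Fin n) × SpaceTime n =>
      phase (heatShift τ q.1) q.2) ((gauss n).prod volume) := by
    refine Measurable.aestronglyMeasurable ?_
    have h1 : Measurable fun q : EuclideanSpace ℝ (Fin n) × SpaceTime n => heatShift τ q.1 := by
      have := continuous_heatShift (n := n).measurable
      exact this.comp (measurable_const.prodMk measurable_fst)
    have h3 := h1.inner (𝕜 := ℝ) measurable_snd
    unfold phase
    fun_prop
  have hint : Integrable (fun q : EuclideanSpace ℝ (Fin n) × SpaceTime n =>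
      phase (heatShift τ q.1) q.2 * ((𝓕 u : L2 n) q.2 * conj ((𝓕 w : L2 n) q.2)))
      ((gauss n).prod volume) :=
    (hG.comp_snd (gauss n)).bdd_mul hph (c := 1)
      (Eventually.of_forall fun q => (norm_phase _ _).le)
  simp_rw [heatPairing, inner_translate]
  rw [integral_integral_swap hint]
  refine integral_congr_ae (Eventually.of_forall fun ζ => ?_)
  simp only
  rw [integral_mul_const, integral_phase_heatShift hτ]

theorem inner_eq_integral_fourier {n : ℕ} (u w : L2 n) :
    inner ℂ w u = ∫ ζ, (𝓕 u : L2 n) ζ * conj ((𝓕 w : L2 n) ζ) := by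
  rw [← Lp.inner_fourier_eq, L2.inner_def]
  refine integral_congr_ae (Eventually.of_forall fun z => ?_)
  simp only [RCLike.inner_apply]

theorem inner_sub_heatPairing {n : ℕ} {τ : ℝ} (hτ : 0 ≤ τ) (u w : L2 n) :
    inner ℂ w u - heatPairing τ u w
      = ∫ ζ, (1 - Complex.exp (-(τ * heatSymbol ζ)))
        * ((𝓕 u : L2 n) ζ * conj ((𝓕 w : L2 n) ζ)) := by
  have hG := integrable_mul_conj (𝓕 u : L2 n) (𝓕 w)
  rw [heatPairing_eq hτ, inner_eq_integral_fourier, ← integral_sub hG]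
  · refine integral_congr_ae (Eventually.of_forall fun ζ => ?_)
    simp only
    ring
  · refine hG.bdd_mul (c := 1) (Measurable.aestronglyMeasurable (by fun_prop))
      (Eventually.of_forall fun ζ => ?_)
    rw [Complex.norm_exp]
    apply Real.exp_le_one_iff.2
    simpa using mul_nonneg hτ (heatSymbol_re_nonneg ζ)

theorem integrable_cpow_mul {n : ℕ} {s : ℝ} (hs0 : 0 < s) (u w : HSpace n s) :
    Integrable (fun ζ => heatSymbol ζ ^ (s : ℂ)
      * ((𝓕 (u : L2 n) : L2 n) ζ * conj ((𝓕 (w : L2 n) : L2 n) ζ))) volume := by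
  refine (integrable_mul_conj (HSpace.weightedₗᵢ n s u) (HSpace.weightedₗᵢ n s w)).mono
    (AEStronglyMeasurable.mul (Measurable.aestronglyMeasurable (by fun_prop))
      (integrable_mul_conj _ _).aestronglyMeasurable) ?_
  filter_upwards [coeFn_weighted u, coeFn_weighted w] with ζ h1 h2
  have h1' : (HSpace.weightedₗᵢ n s u) ζ = (weight s ζ : ℂ) * (𝓕 (u : L2 n) : L2 n) ζ := h1
  have h2' : (HSpace.weightedₗᵢ n s w) ζ = (weight s ζ : ℂ) * (𝓕 (w : L2 n) : L2 n) ζ := h2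
  rw [h1', h2']
  simp only [norm_mul, RCLike.norm_conj, Complex.norm_real, Real.norm_of_nonneg (weight_pos s ζ).le]
  calc _ ≤ weight s ζ ^ 2 * (‖(𝓕 (u : L2 n) : L2 n) ζ‖ * ‖(𝓕 (w : L2 n) : L2 n) ζ‖) := by
        gcongr; exact norm_cpow_le_weight_sq hs0 ζ
    _ = _ := by ring

theorem integrable_subordination {n : ℕ} (hn : 1 ≤ n) {s : ℝ} (hs0 : 0 < s) (hs1 : s < 1)
    (u w : HSpace n s) :
    Integrable (fun q : ℝ × SpaceTime n => (1 - Complex.exp (-(q.1 * heatSymbol q.2)))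
      * ((𝓕 (u : L2 n) : L2 n) q.2 * conj ((𝓕 (w : L2 n) : L2 n) q.2)))
      ((levy s).prod volume) := by
  have hG := integrable_mul_conj (𝓕 (u : L2 n) : L2 n) (𝓕 (w : L2 n))
  have hm : AEStronglyMeasurable (fun q : ℝ × SpaceTime n =>
      (1 - Complex.exp (-(q.1 * heatSymbol q.2)))
      * ((𝓕 (u : L2 n) : L2 n) q.2 * conj ((𝓕 (w : L2 n) : L2 n) q.2)))
      ((levy s).prod volume) :=
    AEStronglyMeasurable.mul (Measurable.aestronglyMeasurable (by fun_prop))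
      (hG.aestronglyMeasurable.comp_quasiMeasurePreserving Measure.quasiMeasurePreserving_snd)
  refine ⟨hm, ?_⟩
  rw [HasFiniteIntegral, lintegral_prod_symm _ hm.enorm]
  set K := ∫⁻ τ, ENNReal.ofReal (2 * min 1 τ) ∂levy s with hK
  have hKfin : K < ∞ := ((integrable_min_levy hs0 hs1).const_mul 2).lintegral_lt_top
  calc _ ≤ ∫⁻ ζ, K * ‖heatSymbol ζ ^ (s : ℂ)
        * ((𝓕 (u : L2 n) : L2 n) ζ * conj ((𝓕 (w : L2 n) : L2 n) ζ))‖ₑ := by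
        refine lintegral_mono_ae ?_
        filter_upwards [ae_heatSymbol_re_pos hn] with ζ hζ
        have hz0 : heatSymbol ζ ≠ 0 := by
          intro h; rw [h] at hζ; simp at hζ
        rw [lintegral_congr fun τ => enorm_mul (1 - Complex.exp (-((τ : ℝ) * heatSymbol ζ))) _,
          lintegral_mul_const _ (by fun_prop), enorm_mul (heatSymbol ζ ^ (s : ℂ)), ← mul_assoc]
        gcongr
        refine (lintegral_levy_one_sub_exp_le s hζ.le hz0).trans (le_of_eq ?_)
        rw [← ofReal_norm (heatSymbol ζ ^ (s : ℂ)), Complex.norm_cpow_real, mul_comm]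
    _ = K * ∫⁻ ζ, ‖heatSymbol ζ ^ (s : ℂ)
        * ((𝓕 (u : L2 n) : L2 n) ζ * conj ((𝓕 (w : L2 n) : L2 n) ζ))‖ₑ :=
        lintegral_const_mul' _ _ hKfin.ne
    _ < ∞ := ENNReal.mul_lt_top hKfin (integrable_cpow_mul hs0 u w).hasFiniteIntegral

theorem integrable_inner_sub_heatPairing {n : ℕ} (hn : 1 ≤ n) {s : ℝ} (hs0 : 0 < s) (hs1 : s < 1)
    (u w : HSpace n s) :
    Integrable (fun τ => inner ℂ (w : L2 n) (u : L2 n) - heatPairing τ (u : L2 n) (w : L2 n))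
      (levy s) := by
  refine (integrable_subordination hn hs0 hs1 u w).integral_prod_left.congr ?_
  filter_upwards [ae_levy_pos s] with τ hτ
  rw [inner_sub_heatPairing hτ.le]

/-- The Balakrishnan formula: the form of `(∂ₜ - Δ) ^ s` is a superposition of the forms of
`1 - P τ`, with `P τ` the translation in time by `τ` composed with the heat flow. -/
theorem integral_inner_sub_heatPairing {n : ℕ} (hn : 1 ≤ n) {s : ℝ} (hs0 : 0 < s) (hs1 : s < 1)
    (u w : HSpace n s) :
    ∫ τ, (inner ℂ (w : L2 n) (u : L2 n) - heatPairing τ (u : L2 n) (w : L2 n)) ∂levy s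
      = levyConst s * mainForm s (u : L2 n) (w : L2 n) := by
  have h1 : ∫ τ, (inner ℂ (w : L2 n) (u : L2 n) - heatPairing τ (u : L2 n) (w : L2 n)) ∂levy s
      = ∫ τ, ∫ ζ, (1 - Complex.exp (-((τ : ℝ) * heatSymbol ζ)))
        * ((𝓕 (u : L2 n) : L2 n) ζ * conj ((𝓕 (w : L2 n) : L2 n) ζ)) ∂volume ∂levy s := by
    refine integral_congr_ae ?_
    filter_upwards [ae_levy_pos s] with τ hτ
    rw [inner_sub_heatPairing hτ.le]
  rw [h1, integral_integral_swap (integrable_subordination hn hs0 hs1 u w), mainForm,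
    ← integral_const_mul]
  refine integral_congr_ae ?_
  filter_upwards [ae_heatSymbol_re_pos hn] with ζ hζ
  rw [integral_mul_const, integral_levy_one_sub_exp hs0 hs1 hζ]
  ring

theorem inner_translate_eq {n : ℕ} (h : SpaceTime n) (u w : L2 n) :
    inner ℂ w (translate h u) = ∫ z, u (z - h) * conj (w z) := by
  rw [L2.inner_def]
  refine integral_congr_ae ?_
  filter_upwards [coeFn_translate h u] with z hz
  rw [hz, RCLike.inner_apply]

theorem inner_eq_integral {n : ℕ} (u w : L2 n) :
    inner ℂ w u = ∫ z, u z * conj (w z) := by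
  rw [L2.inner_def]
  refine integral_congr_ae (Eventually.of_forall fun z => ?_)
  simp only [RCLike.inner_apply]

/-- Causality: `(∂ₜ - Δ) ^ s u` at times before `T` does not see `u` at times after `T`. -/
theorem mainForm_eq_zero_of_causal {n : ℕ} (hn : 1 ≤ n) {s : ℝ} (hs0 : 0 < s) (hs1 : s < 1) {T : ℝ}
    (u w : HSpace n s) (hu : ∀ᵐ z : SpaceTime n, z.fst < T → (u : L2 n) z = 0)
    (hw : ∀ᵐ z : SpaceTime n, T < z.fst → (w : L2 n) z = 0) :
    mainForm s (u : L2 n) (w : L2 n) = 0 := by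
  have h1 : inner ℂ (w : L2 n) (u : L2 n) = 0 := by
    rw [inner_eq_integral]
    refine integral_eq_zero_of_ae ?_
    filter_upwards [hu, hw, ae_fst_ne (n := n) T] with z h1 h2 h3
    rcases lt_or_gt_of_ne h3 with h | h
    · simp [h1 h]
    · simp [h2 h]
  have h2 : ∀ τ, 0 < τ → heatPairing τ (u : L2 n) (w : L2 n) = 0 := by
    intro τ hτ
    refine integral_eq_zero_of_ae (Eventually.of_forall fun y => ?_)
    simp only [Pi.zero_apply]
    rw [inner_translate_eq]
    refine integral_eq_zero_of_ae ?_
    have hu' := (measurePreserving_sub_right volume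
      (heatShift τ y : SpaceTime n)).quasiMeasurePreserving.ae hu
    filter_upwards [hu', hw] with z h3 h4
    have h7 : (z - heatShift τ y : SpaceTime n).fst = z.fst - τ := rfl
    rw [h7] at h3
    rcases lt_or_ge T z.fst with h | h
    · simp [h4 h]
    · simp [h3 (by linarith)]
  have h3 := integral_inner_sub_heatPairing hn hs0 hs1 u w
  rw [integral_eq_zero_of_ae] at h3
  · have hc := levyConst_pos hs0 hs1
    exact (mul_eq_zero.1 h3.symm).resolve_left (by exact_mod_cast hc.ne')
  · filter_upwards [ae_levy_pos s] with τ hτ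
    rw [h1, h2 τ hτ]; simp

/-! ### Conjugation by exponentials of time -/

/-- The function `exp (μ t)` on `[-T, T]`, extended by constants. -/
def expWeight (μ T t : ℝ) : ℝ := Real.exp (μ * max (-T) (min t T))

theorem abs_clamp_le {T : ℝ} (hT : 0 < T) (t : ℝ) : |max (-T) (min t T)| ≤ T := by
  rw [abs_le]
  exact ⟨le_max_left _ _, max_le (by linarith) (min_le_right _ _)⟩

@[fun_prop]
theorem measurable_expWeight (μ T : ℝ) : Measurable (expWeight μ T) := by
  unfold expWeight; fun_prop

theorem expWeight_pos (μ T t : ℝ) : 0 < expWeight μ T t := Real.exp_pos _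

theorem abs_expWeight_le (μ : ℝ) {T : ℝ} (hT : 0 < T) (t : ℝ) :
    |expWeight μ T t| ≤ Real.exp (|μ| * T) := by
  rw [abs_of_pos (expWeight_pos _ _ _), expWeight]
  apply Real.exp_le_exp.2
  calc μ * max (-T) (min t T) ≤ |μ * max (-T) (min t T)| := le_abs_self _
    _ = |μ| * |max (-T) (min t T)| := abs_mul _ _
    _ ≤ |μ| * T := by gcongr; exact abs_clamp_le hT t

theorem abs_expWeight_sub_le (μ : ℝ) {T : ℝ} (hT : 0 < T) (t t' : ℝ) :
    |expWeight μ T t - expWeight μ T t'| ≤ Real.exp (|μ| * T) * |μ| * |t - t'| := by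
  have hclamp : |max (-T) (min t T) - max (-T) (min t' T)| ≤ |t - t'| := by
    have h := ((LipschitzWith.id (α := ℝ)).min_const T).const_max (-T)
    simpa [Real.dist_eq] using h.dist_le_mul t t'
  have hexp : ∀ a b : ℝ, Real.exp a - Real.exp b ≤ Real.exp a * |a - b| := by
    intro a b
    have h1 : Real.exp b = Real.exp a * Real.exp (b - a) := by rw [← Real.exp_add]; ring_nf
    have h2 := Real.add_one_le_exp (b - a)
    have h3 := le_abs_self (a - b)
    have h4 := Real.exp_pos a
    rw [h1]
    nlinarith
  have hone : ∀ t t' : ℝ, |max (-T) (min t T) - max (-T) (min t' T)| ≤ |t - t'| →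
      expWeight μ T t - expWeight μ T t' ≤ Real.exp (|μ| * T) * |μ| * |t - t'| := by
    intro t t' h
    have h1 := (le_abs_self _).trans (abs_expWeight_le μ hT t)
    calc expWeight μ T t - expWeight μ T t'
        ≤ expWeight μ T t * |μ * max (-T) (min t T) - μ * max (-T) (min t' T)| := hexp _ _
      _ ≤ Real.exp (|μ| * T) * (|μ| * |t - t'|) := by
          rw [← mul_sub, abs_mul]
          gcongr
      _ = _ := by ring
  rw [abs_le]
  constructor
  · have := hone t' t (by rw [abs_sub_comm, abs_sub_comm t' t]; exact hclamp)
    rw [abs_sub_comm t' t] at this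
    linarith
  · exact hone t t' hclamp

theorem expWeight_neg_mul (μ T t : ℝ) : expWeight (-μ) T t * expWeight μ T t = 1 := by
  rw [expWeight, expWeight, ← Real.exp_add]
  simp

theorem expWeight_shift (μ : ℝ) {T t τ : ℝ} (h1 : t - τ ∈ Icc (-T) T) (h2 : t ∈ Icc (-T) T) :
    expWeight μ T (t - τ) * expWeight (-μ) T t = Real.exp (-(μ * τ)) := by
  rw [expWeight, expWeight, ← Real.exp_add, min_eq_left h1.2, min_eq_left h2.2,
    max_eq_right h1.1, max_eq_right h2.1]
  congr 1; ring

theorem exists_expMul_HSpace {n : ℕ} (hn : 1 ≤ n) {s : ℝ} (hs0 : 0 < s) (hs1 : s < 1)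
    (μ : ℝ) {T : ℝ} (hT : 0 < T) :
    ∃ M : HSpace n s →L[ℂ] HSpace n s, ∀ u, ((M u : L2 n) : SpaceTime n → ℂ)
      =ᵐ[volume] fun z => expWeight μ T z.fst * (u : L2 n) z :=
  exists_mul_HSpace_of_lipschitz hn hs0 hs1 (measurable_expWeight μ T) (abs_expWeight_le μ hT)
    (abs_expWeight_sub_le μ hT)

theorem inner_exp_mul {n : ℕ} (μ T : ℝ) {v v₁ v₂ : L2 n}
    (h1 : v₁ =ᵐ[volume] fun z => expWeight μ T z.fst * v z)
    (h2 : v₂ =ᵐ[volume] fun z => expWeight (-μ) T z.fst * v z)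
    {q : SpaceTime n → ℂ} (hq : MemLp q ∞ volume) :
    inner ℂ v₂ (mulLp hq v₁) = inner ℂ v (mulLp hq v) := by
  rw [inner_eq_integral, inner_eq_integral]
  refine integral_congr_ae ?_
  filter_upwards [h1, h2, coeFn_mulLp hq v₁, coeFn_mulLp hq v] with z h1 h2 h3 h4
  rw [h3, h4, h1, h2, map_mul, Complex.conj_ofReal]
  have h5 : (expWeight (-μ) T z.fst : ℂ) * expWeight μ T z.fst = 1 := by
    exact_mod_cast expWeight_neg_mul μ T z.fst
  linear_combination (q z * v z * conj (v z)) * h5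

theorem inner_exp_mul' {n : ℕ} (μ T : ℝ) {v v₁ v₂ : L2 n}
    (h1 : v₁ =ᵐ[volume] fun z => expWeight μ T z.fst * v z)
    (h2 : v₂ =ᵐ[volume] fun z => expWeight (-μ) T z.fst * v z) :
    inner ℂ v₂ v₁ = inner ℂ v v := by
  rw [inner_eq_integral, inner_eq_integral]
  refine integral_congr_ae ?_
  filter_upwards [h1, h2] with z h1 h2
  rw [h1, h2, map_mul, Complex.conj_ofReal]
  have h5 : (expWeight (-μ) T z.fst : ℂ) * expWeight μ T z.fst = 1 := by
    exact_mod_cast expWeight_neg_mul μ T z.fst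
  linear_combination (v z * conj (v z)) * h5

/-- For functions supported in `[-T, T]`, conjugation by `exp (μ t)` multiplies the heat flow at
time `τ` by `exp (-μ τ)`. -/
theorem heatPairing_exp {n : ℕ} (μ : ℝ) {T τ : ℝ} {v v₁ v₂ : L2 n}
    (hv : ∀ᵐ z : SpaceTime n, z.fst ∉ Icc (-T) T → v z = 0)
    (h1 : v₁ =ᵐ[volume] fun z => expWeight μ T z.fst * v z)
    (h2 : v₂ =ᵐ[volume] fun z => expWeight (-μ) T z.fst * v z) :
    heatPairing τ v₁ v₂ = Real.exp (-(μ * τ)) * heatPairing τ v v := by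
  rw [heatPairing, heatPairing, ← integral_const_mul]
  refine integral_congr_ae (Eventually.of_forall fun y => ?_)
  simp only
  rw [inner_translate_eq, inner_translate_eq, ← integral_const_mul]
  refine integral_congr_ae ?_
  have hq := (measurePreserving_sub_right volume
    (heatShift τ y : SpaceTime n)).quasiMeasurePreserving
  filter_upwards [hq.ae h1, hq.ae hv, h2, hv] with z h3 h4 h5 h6
  have h7 : (z - heatShift τ y : SpaceTime n).fst = z.fst - τ := rfl
  rw [h7] at h3 h4
  rw [h3, h5, map_mul, Complex.conj_ofReal]
  by_cases h8 : z.fst - τ ∈ Icc (-T) T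
  · by_cases h9 : z.fst ∈ Icc (-T) T
    · have h10 : (expWeight μ T (z.fst - τ) : ℂ) * expWeight (-μ) T z.fst
          = Real.exp (-(μ * τ)) := by
        exact_mod_cast expWeight_shift μ h8 h9
      linear_combination (v (z - heatShift τ y) * conj (v z)) * h10
    · simp [h6 h9]
  · simp [h4 h8]

theorem norm_heatPairing_le {n : ℕ} (τ : ℝ) (u w : L2 n) :
    ‖heatPairing τ u w‖ ≤ ‖u‖ * ‖w‖ := by
  have h := norm_integral_le_of_norm_le_const (μ := gauss n) (C := ‖u‖ * ‖w‖)
    (f := fun y => inner ℂ w (translate (heatShift τ y) u)) (Eventually.of_forall fun y => ?_)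
  · simpa [heatPairing] using h
  · refine (norm_inner_le_norm _ _).trans (le_of_eq ?_)
    rw [LinearIsometry.norm_map, mul_comm]

theorem integral_levy_one_sub_rexp {s : ℝ} (hs0 : 0 < s) (hs1 : s < 1) {r : ℝ} (hr : 0 < r) :
    ∫ τ, (1 - Real.exp (-(r * τ))) ∂levy s = levyConst s * r ^ s := by
  have h := integral_levy_one_sub_exp hs0 hs1 (z := r) (by simpa using hr)
  rw [← Complex.ofReal_cpow hr.le] at h
  apply Complex.ofReal_injective
  rw [← integral_complex_ofReal]
  push_cast
  rw [← h]
  refine integral_congr_ae (Eventually.of_forall fun τ => ?_)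
  simp only [mul_comm]

/-- Lower bounds for the conjugated form, with the integrand
`‖v‖² - exp (-μ τ) Re (P τ v, v)` and `|(P τ v, v)| ≤ ‖v‖²`. -/
theorem mainForm_exp_re_ge {n : ℕ} (hn : 1 ≤ n) {s : ℝ} (hs0 : 0 < s) (hs1 : s < 1) {μ T : ℝ}
    (hμ : 0 < μ) {v v₁ v₂ : HSpace n s}
    (hv : ∀ᵐ z : SpaceTime n, z.fst ∉ Icc (-T) T → (v : L2 n) z = 0)
    (h1 : ((v₁ : L2 n) : SpaceTime n → ℂ) =ᵐ[volume] fun z => expWeight μ T z.fst * (v : L2 n) z)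
    (h2 : ((v₂ : L2 n) : SpaceTime n → ℂ) =ᵐ[volume]
      fun z => expWeight (-μ) T z.fst * (v : L2 n) z) :
    (mainForm s (v : L2 n) (v : L2 n)).re + μ ^ s * ‖(v : L2 n)‖ ^ 2
      ≤ 3 * (mainForm s (v₁ : L2 n) (v₂ : L2 n)).re := by
  have hc := levyConst_pos hs0 hs1
  set N : ℝ := ‖(v : L2 n)‖ ^ 2 with hN
  set p : ℝ → ℝ := fun τ => (heatPairing τ (v : L2 n) (v : L2 n)).re with hp
  have hNi : inner ℂ (v : L2 n) (v : L2 n) = (N : ℂ) := by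
    rw [inner_self_eq_norm_sq_to_K, hN]; push_cast; rfl
  have hpN : ∀ τ, |p τ| ≤ N := fun τ => by
    refine (Complex.abs_re_le_norm _).trans ((norm_heatPairing_le _ _ _).trans (le_of_eq ?_))
    rw [hN]; ring
  -- the two subordination formulas, in real form
  have hi0 := integrable_inner_sub_heatPairing hn hs0 hs1 v v
  have he0 := integral_inner_sub_heatPairing hn hs0 hs1 v v
  have hi1 := integrable_inner_sub_heatPairing hn hs0 hs1 v₁ v₂
  have he1 := integral_inner_sub_heatPairing hn hs0 hs1 v₁ v₂
  have hi0' : Integrable (fun τ => N - p τ) (levy s) := by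
    refine hi0.re.congr (Eventually.of_forall fun τ => ?_)
    simp only [hNi, hp, RCLike.re_to_complex, Complex.sub_re, Complex.ofReal_re]
  have he0' : ∫ τ, (N - p τ) ∂levy s
      = levyConst s * (mainForm s (v : L2 n) (v : L2 n)).re := by
    rw [← Complex.re_ofReal_mul, ← he0]
    refine Eq.trans ?_ (integral_re hi0)
    refine integral_congr_ae (Eventually.of_forall fun τ => ?_)
    simp only [hNi, hp, RCLike.re_to_complex, Complex.sub_re, Complex.ofReal_re]
  have hpt : ∀ τ, (inner ℂ (v₂ : L2 n) (v₁ : L2 n) - heatPairing τ (v₁ : L2 n) (v₂ : L2 n)).re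
      = N - Real.exp (-(μ * τ)) * p τ := by
    intro τ
    rw [inner_exp_mul' μ T h1 h2, heatPairing_exp μ hv h1 h2, hNi, Complex.sub_re,
      Complex.ofReal_re, Complex.re_ofReal_mul]
  have hi1' : Integrable (fun τ => N - Real.exp (-(μ * τ)) * p τ) (levy s) :=
    hi1.re.congr (Eventually.of_forall hpt)
  have he1' : ∫ τ, (N - Real.exp (-(μ * τ)) * p τ) ∂levy s
      = levyConst s * (mainForm s (v₁ : L2 n) (v₂ : L2 n)).re := by
    rw [← Complex.re_ofReal_mul, ← he1]
    refine Eq.trans ?_ (integral_re hi1)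
    exact integral_congr_ae (Eventually.of_forall fun τ => (hpt τ).symm)
  have hi2 : Integrable (fun τ => (1 - Real.exp (-(μ * τ))) * N) (levy s) := by
    have := integrable_one_sub_rexp_levy hs0 hs1 hμ.le
    simp_rw [mul_comm _ μ] at this
    exact this.mul_const N
  have he2 : ∫ τ, (1 - Real.exp (-(μ * τ))) * N ∂levy s = levyConst s * μ ^ s * N := by
    rw [integral_mul_const, integral_levy_one_sub_rexp hs0 hs1 hμ]
  have hA : levyConst s * μ ^ s * N ≤ levyConst s * (mainForm s (v₁ : L2 n) (v₂ : L2 n)).re := by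
    rw [← he1', ← he2]
    refine integral_mono hi2 hi1' fun τ => ?_
    have := Real.exp_pos (-(μ * τ))
    have := (abs_le.1 (hpN τ)).2
    simp only
    nlinarith
  have hB : levyConst s * (mainForm s (v : L2 n) (v : L2 n)).re
      ≤ levyConst s * (mainForm s (v₁ : L2 n) (v₂ : L2 n)).re + levyConst s * μ ^ s * N := by
    rw [← he1', ← he0', ← he2, ← integral_add hi1' hi2]
    refine integral_mono_ae hi0' (hi1'.add hi2) ?_
    filter_upwards [ae_levy_pos s] with τ hτ
    have h3 : Real.exp (-(μ * τ)) ≤ 1 := Real.exp_le_one_iff.2 (by nlinarith)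
    have h4 := (abs_le.1 (hpN τ)).1
    nlinarith
  have hA' : μ ^ s * N ≤ (mainForm s (v₁ : L2 n) (v₂ : L2 n)).re := by
    rw [mul_assoc] at hA; exact le_of_mul_le_mul_left hA hc
  have hB' : (mainForm s (v : L2 n) (v : L2 n)).re
      ≤ (mainForm s (v₁ : L2 n) (v₂ : L2 n)).re + μ ^ s * N := by
    rw [mul_assoc, ← mul_add] at hB; exact le_of_mul_le_mul_left hB hc
  linarith

theorem sector_mul_norm_sq_le {n : ℕ} (hn : 1 ≤ n) {s : ℝ} (hs0 : 0 < s) (hs1 : s < 1)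
    (v : HSpace n s) :
    sector s * ‖v‖ ^ 2 ≤ sector s * ‖(v : L2 n)‖ ^ 2 + (mainForm s (v : L2 n) (v : L2 n)).re := by
  have hc := levyConst_pos hs0 hs1
  have hk := sector_pos hs0 hs1
  have hnn : ∀ ζ : SpaceTime n, 0 ≤ (heatSymbol ζ ^ (s : ℂ)).re := fun ζ =>
    le_trans (by positivity) (sector_mul_le_re_cpow hs0 hs1 (heatSymbol_re_nonneg ζ))
  set R : ℝ := (mainForm s (v : L2 n) (v : L2 n)).re with hR
  have hRe : ∀ ζ, (heatSymbol ζ ^ (s : ℂ)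
      * ((𝓕 (v : L2 n) : L2 n) ζ * conj ((𝓕 (v : L2 n) : L2 n) ζ))).re
      = (heatSymbol ζ ^ (s : ℂ)).re * ‖(𝓕 (v : L2 n) : L2 n) ζ‖ ^ 2 := by
    intro ζ
    rw [Complex.mul_conj, Complex.re_mul_ofReal, Complex.normSq_eq_norm_sq]
  have hint := integrable_cpow_mul hs0 v v
  have hint' : Integrable (fun ζ => (heatSymbol ζ ^ (s : ℂ)).re
      * ‖(𝓕 (v : L2 n) : L2 n) ζ‖ ^ 2) volume := hint.re.congr (Eventually.of_forall hRe)
  have hR' : R = ∫ ζ, (heatSymbol ζ ^ (s : ℂ)).re * ‖(𝓕 (v : L2 n) : L2 n) ζ‖ ^ 2 := by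
    rw [hR, mainForm]
    refine (integral_re hint).symm.trans ?_
    exact integral_congr_ae (Eventually.of_forall hRe)
  have hR0 : 0 ≤ R := by
    rw [hR']; exact integral_nonneg fun ζ => mul_nonneg (hnn ζ) (by positivity)
  have hen : energy s (v : L2 n) = ENNReal.ofReal (2 * levyConst s * R) := by
    rw [energy_eq hn hs0 hs1, ENNReal.ofReal_mul (by positivity), hR',
      ofReal_integral_eq_lintegral_ofReal hint'
        (Eventually.of_forall fun ζ => mul_nonneg (hnn ζ) (by positivity)),
      ← lintegral_const_mul' _ _ (by finiteness)]
    refine lintegral_congr fun ζ => ?_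
    rw [ENNReal.ofReal_mul (p := 2 * levyConst s) (by positivity), ENNReal.ofReal_mul (hnn ζ),
      ENNReal.ofReal_pow (norm_nonneg _), ofReal_norm, mul_assoc]
  have h1 := lintegral_weight_le hn hs0 hs1 (v : L2 n)
  rw [← HSpace.enorm_sq, hen, ← ofReal_norm, ← ofReal_norm, ← ENNReal.ofReal_pow (norm_nonneg _),
    ← ENNReal.ofReal_pow (norm_nonneg _), ← ENNReal.ofReal_mul (by positivity),
    ← ENNReal.ofReal_add (by positivity) (by positivity),
    ENNReal.ofReal_le_ofReal_iff (by positivity)] at h1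
  have h2 : (2 * levyConst s * sector s)⁻¹ * (2 * levyConst s * R) = R / sector s := by field_simp
  rw [h2] at h1
  calc sector s * ‖v‖ ^ 2 ≤ sector s * (‖(v : L2 n)‖ ^ 2 + R / sector s) := by gcongr
    _ = _ := by field_simp

/-! ### The weak form as a bounded operator -/

theorem measurableSet_cyl {n : ℕ} (T : ℝ) {Ω : Set (EuclideanSpace ℝ (Fin n))} (hΩ : IsOpen Ω) :
    MeasurableSet (cyl T Ω) := by
  have h2 : Measurable fun z : SpaceTime n => z.snd := (WithLp.continuous_snd 2 _ _).measurable
  exact (measurable_fst_spaceTime measurableSet_Ioo).inter (h2 hΩ.measurableSet)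

theorem memLp_indicator_cyl {n : ℕ} {T : ℝ} {Ω : Set (EuclideanSpace ℝ (Fin n))} (hΩ : IsOpen Ω)
    {Q : SpaceTime n → ℝ} (hQ : MemLp Q ∞ (volume.restrict (cyl T Ω))) :
    MemLp ((cyl T Ω).indicator fun z => (Q z : ℂ)) ∞ volume :=
  (memLp_indicator_iff_restrict (measurableSet_cyl T hΩ)).2 hQ.ofReal

theorem pairing_cyl_eq_inner {n : ℕ} {T : ℝ} {Ω : Set (EuclideanSpace ℝ (Fin n))} (hΩ : IsOpen Ω)
    {Q : SpaceTime n → ℝ} (hQ : MemLp Q ∞ (volume.restrict (cyl T Ω))) (u w : L2 n) :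
    pairing (cyl T Ω) (fun z => (Q z : ℂ) * u z) w
      = inner ℂ w (mulLp (memLp_indicator_cyl hΩ hQ) u) := by
  rw [pairing, inner_eq_integral, ← integral_indicator (measurableSet_cyl T hΩ)]
  refine integral_congr_ae ?_
  filter_upwards [coeFn_mulLp (memLp_indicator_cyl hΩ hQ) u] with z hz
  rw [hz]
  by_cases h : z ∈ cyl T Ω <;> simp [h]

/-- The form `B_Q(u, w) - lam (u, w)_{Ω_T}`. -/
def weakForm {n : ℕ} (s T : ℝ) (Ω : Set (EuclideanSpace ℝ (Fin n))) (Q : SpaceTime n → ℝ)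
    (lam : ℝ) (u w : HSpace n s) : ℂ :=
  BForm s T Ω Q u w - (lam : ℂ) * pairing (cyl T Ω) (u : L2 n) (w : L2 n)

/-- Multiplication by `χ (Q - lam)`, with `χ` the indicator function of `Ω_T`. -/
def potential {n : ℕ} {T : ℝ} {Ω : Set (EuclideanSpace ℝ (Fin n))} (hΩ : IsOpen Ω)
    {Q : SpaceTime n → ℝ} (hQ : MemLp Q ∞ (volume.restrict (cyl T Ω))) (lam : ℝ) :
    L2 n →L[ℂ] L2 n :=
  mulLp (memLp_indicator_cyl hΩ hQ)
    - (lam : ℂ) • mulLp (memLp_indicator_cyl (T := T) hΩ (memLp_top_const 1))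

theorem inner_potential {n : ℕ} {T : ℝ} {Ω : Set (EuclideanSpace ℝ (Fin n))} (hΩ : IsOpen Ω)
    {Q : SpaceTime n → ℝ} (hQ : MemLp Q ∞ (volume.restrict (cyl T Ω))) (lam : ℝ) (u w : L2 n) :
    inner ℂ w (potential hΩ hQ lam u) = pairing (cyl T Ω) (fun z => (Q z : ℂ) * u z) w
      - (lam : ℂ) * pairing (cyl T Ω) u w := by
  have h := pairing_cyl_eq_inner (T := T) hΩ (memLp_top_const (1 : ℝ)) u w
  simp only [Complex.ofReal_one, one_mul] at h
  rw [potential, pairing_cyl_eq_inner hΩ hQ, h, sub_apply,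
    smul_apply, inner_sub_right, inner_smul_right]

theorem weakForm_eq {n : ℕ} {s : ℝ} (hs0 : 0 < s) {T : ℝ} {Ω : Set (EuclideanSpace ℝ (Fin n))}
    (hΩ : IsOpen Ω) {Q : SpaceTime n → ℝ} (hQ : MemLp Q ∞ (volume.restrict (cyl T Ω))) (lam : ℝ)
    (u w : HSpace n s) :
    weakForm s T Ω Q lam u w = mainForm s (u : L2 n) (w : L2 n)
      + inner ℂ (w : L2 n) (potential hΩ hQ lam (u : L2 n)) := by
  rw [weakForm, BForm, pairing_fracHeat hs0, inner_potential]
  ring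

theorem exists_weakForm_operator {n : ℕ} {s : ℝ} (hs0 : 0 < s) {T : ℝ}
    {Ω : Set (EuclideanSpace ℝ (Fin n))} (hΩ : IsOpen Ω) {Q : SpaceTime n → ℝ}
    (hQ : MemLp Q ∞ (volume.restrict (cyl T Ω))) (lam : ℝ) :
    ∃ A : HSpace n s →L[ℂ] HSpace n s, ∀ u w, inner ℂ w (A u) = weakForm s T Ω Q lam u w := by
  have := completeSpace_HSpace n hs0.le
  let W : HSpace n s →L[ℂ] L2 n := (HSpace.weightedₗᵢ n s).toContinuousLinearMap
  let J : HSpace n s →L[ℂ] L2 n := HSpace.inclL n hs0.le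
  refine ⟨(ContinuousLinearMap.adjoint W).comp ((mulLp (memLp_normSymbol hs0)).comp W)
    + (ContinuousLinearMap.adjoint J).comp ((potential hΩ hQ lam).comp J), fun u w => ?_⟩
  rw [weakForm_eq hs0 hΩ hQ, mainForm_eq_inner hs0, add_apply, inner_add_right]
  simp only [ContinuousLinearMap.comp_apply, ContinuousLinearMap.adjoint_inner_right]
  rfl

/-! ### Solvability on functions supported in the cylinder -/

theorem isClosed_HSupp {n : ℕ} {a : ℝ} (ha : 0 ≤ a) {E : Set (SpaceTime n)}
    (hE : MeasurableSet E) : IsClosed (HSupp n a E : Set (HSpace n a)) := by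
  have hφ : MemLp (Eᶜ.indicator fun _ : SpaceTime n => (1 : ℂ)) ∞ volume :=
    (memLp_indicator_iff_restrict hE.compl).2 (memLp_top_const 1)
  let L : HSpace n a →L[ℂ] L2 n := (mulLp hφ).comp (HSpace.inclL n ha)
  have h : (HSupp n a E : Set (HSpace n a)) = {u | L u = 0} := by
    ext u
    have hL : (L u : SpaceTime n → ℂ) =ᵐ[volume] fun z =>
      Eᶜ.indicator (fun _ : SpaceTime n => (1 : ℂ)) z * (u : L2 n) z := coeFn_mulLp hφ _
    constructor
    · intro hu
      have hu : ∀ᵐ z : SpaceTime n, z ∉ E → (u : L2 n) z = 0 := hu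
      refine Lp.ext ?_
      filter_upwards [hL, hu, Lp.coeFn_zero ℂ 2 (volume : Measure (SpaceTime n))] with z h1 h2 h3
      rw [h1, h3]
      by_cases hz : z ∈ E
      · simp [hz]
      · simp [h2 hz]
    · intro hu
      have hu : L u = 0 := hu
      change ∀ᵐ z : SpaceTime n, z ∉ E → (u : L2 n) z = 0
      rw [hu] at hL
      filter_upwards [hL, Lp.coeFn_zero ℂ 2 (volume : Measure (SpaceTime n))] with z h1 h3 hz
      rw [h3] at h1
      simpa [hz] using h1.symm
  rw [h]
  exact isClosed_eq L.continuous continuous_const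

theorem exists_of_coercive {H : Type*} [NormedAddCommGroup H] [InnerProductSpace ℂ H]
    [CompleteSpace H] (A : H →L[ℂ] H) {α : ℝ} (hα : 0 < α)
    (h : ∀ v, α * ‖v‖ ^ 2 ≤ (inner ℂ v (A v)).re) (F : H →SL[starRingEnd ℂ] ℂ) :
    ∃ u, (∀ w, inner ℂ w (A u) = F w) ∧ ‖u‖ ≤ α⁻¹ * ‖F‖ := by
  have hunit : IsUnit A := by
    refine ContinuousLinearMap.isUnit_of_forall_le_norm_inner_map A (c := Real.toNNReal α)
      (Real.toNNReal_pos.2 hα) fun x => ?_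
    rw [Real.coe_toNNReal _ hα.le]
    rw [norm_inner_symm, mul_comm]
    exact (h x).trans (Complex.re_le_norm _)
  let G : StrongDual ℂ H := LinearMap.mkContinuous
    { toFun := fun w => conj (F w)
      map_add' := fun x y => by simp
      map_smul' := fun c x => by simp } ‖F‖ fun w => by
        simpa using F.le_opNorm w
  obtain ⟨u, hu⟩ := (ContinuousLinearMap.isUnit_iff_bijective.1 hunit).2
    ((InnerProductSpace.toDual ℂ H).symm G)
  have hsol : ∀ w, inner ℂ w (A u) = F w := by
    intro w
    rw [hu, ← inner_conj_symm, InnerProductSpace.toDual_symm_apply]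
    exact Complex.conj_conj _
  refine ⟨u, hsol, ?_⟩
  rcases eq_or_ne u 0 with rfl | hu0
  · rw [norm_zero]; positivity
  have hpos : 0 < ‖u‖ := norm_pos_iff.2 hu0
  have h1 : α * ‖u‖ ^ 2 ≤ ‖F‖ * ‖u‖ := by
    refine (h u).trans ((Complex.re_le_norm _).trans ?_)
    rw [hsol]; exact F.le_opNorm u
  rw [inv_mul_eq_div, le_div_iff₀ hα]
  refine le_of_mul_le_mul_right ?_ hpos
  calc ‖u‖ * α * ‖u‖ = α * ‖u‖ ^ 2 := by ring
    _ ≤ _ := h1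

/-- Solvability of `⟪w, A v⟫ = F w` on a subspace when the form is coercive after conjugation by
operators `M` and `N = M⁻¹` preserving the subspace. -/
theorem exists_of_conjugate_coercive {H : Type*} [NormedAddCommGroup H] [InnerProductSpace ℂ H]
    [CompleteSpace H] (V : Submodule ℂ H) [CompleteSpace V] (A M N : H →L[ℂ] H)
    (hM : ∀ v ∈ V, M v ∈ V) (hN : ∀ v ∈ V, N v ∈ V) (hNM : ∀ v, N (M v) = v) {α : ℝ} (hα : 0 < α)
    (hco : ∀ v ∈ V, α * ‖v‖ ^ 2 ≤ (inner ℂ (N v) (A (M v))).re) :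
    ∃ C : ℝ, 0 < C ∧ ∀ F : V →SL[starRingEnd ℂ] ℂ, ∃ v : V,
      (∀ w : V, inner ℂ (w : H) (A v) = F w) ∧ ‖(v : H)‖ ≤ C * ‖F‖ := by
  let MV : V →L[ℂ] V := (M.comp V.subtypeL).codRestrict V fun v => hM v v.2
  let NV : V →L[ℂ] V := (N.comp V.subtypeL).codRestrict V fun v => hN v v.2
  let AV : V →L[ℂ] V := (ContinuousLinearMap.adjoint (N.comp V.subtypeL)).comp
    (A.comp (M.comp V.subtypeL))
  have hAV : ∀ v w : V, inner ℂ w (AV v) = inner ℂ (N w) (A (M v)) := fun v w =>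
    ContinuousLinearMap.adjoint_inner_right (N.comp V.subtypeL) w (A (M v))
  refine ⟨‖M‖ * α⁻¹ * ‖NV‖ + 1, by positivity, fun F => ?_⟩
  obtain ⟨v, hv, hvn⟩ := exists_of_coercive AV hα
    (fun v => by rw [hAV]; exact hco v v.2) (F.comp NV)
  refine ⟨MV v, fun w => ?_, ?_⟩
  · have h1 := hv (MV w)
    rw [hAV] at h1
    have h2 : N (MV w : H) = w := hNM w
    have h3 : (F.comp NV) (MV w) = F w := congrArg F (Subtype.ext h2)
    rw [h2, h3] at h1
    exact h1
  · calc ‖((MV v : V) : H)‖ = ‖M v‖ := rfl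
      _ ≤ ‖M‖ * ‖v‖ := M.le_opNorm _
      _ ≤ ‖M‖ * (α⁻¹ * (‖F‖ * ‖NV‖)) := by
          gcongr
          exact hvn.trans (by gcongr; exact F.opNorm_comp_le NV)
      _ = ‖M‖ * α⁻¹ * ‖NV‖ * ‖F‖ := by ring
      _ ≤ (‖M‖ * α⁻¹ * ‖NV‖ + 1) * ‖F‖ := by
          gcongr; linarith

theorem closure_cyl_subset {n : ℕ} {T : ℝ} {Ω : Set (EuclideanSpace ℝ (Fin n))}
    {z : SpaceTime n} (hz : z ∈ closure (cyl T Ω)) : z.fst ∈ Icc (-T) T ∧ z.snd ∈ closure Ω := by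
  have hc : IsClosed {z : SpaceTime n | z.fst ∈ Icc (-T) T ∧ z.snd ∈ closure Ω} :=
    (isClosed_Icc.preimage (WithLp.continuous_fst 2 _ _)).inter
      (isClosed_closure.preimage (WithLp.continuous_snd 2 _ _))
  have hsub : cyl T Ω ⊆ {z : SpaceTime n | z.fst ∈ Icc (-T) T ∧ z.snd ∈ closure Ω} :=
    fun z hz => ⟨Ioo_subset_Icc_self hz.1, subset_closure hz.2⟩
  exact closure_minimal hsub hc hz

theorem mem_closure_cyl {n : ℕ} {T : ℝ} {Ω : Set (EuclideanSpace ℝ (Fin n))}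
    {z : SpaceTime n} (h1 : z.fst ∈ Ioo (-T) T) (h2 : z.snd ∈ closure Ω) :
    z ∈ closure (cyl T Ω) := by
  let e := WithLp.homeomorphProd 2 ℝ (EuclideanSpace ℝ (Fin n))
  have h : cyl T Ω = e ⁻¹' (Ioo (-T) T ×ˢ Ω) := rfl
  rw [h, ← e.preimage_closure, closure_prod_eq]
  exact ⟨subset_closure h1, h2⟩

theorem HSupp_time {n : ℕ} {s T : ℝ} {Ω : Set (EuclideanSpace ℝ (Fin n))} {v : HSpace n s}
    (hv : v ∈ HSupp n s (closure (cyl T Ω))) :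
    ∀ᵐ z : SpaceTime n, z.fst ∉ Icc (-T) T → (v : L2 n) z = 0 := by
  have hv : ∀ᵐ z : SpaceTime n, z ∉ closure (cyl T Ω) → (v : L2 n) z = 0 := hv
  filter_upwards [hv] with z hz h
  exact hz fun h' => h (closure_cyl_subset h').1

theorem mul_mem_HSupp {n : ℕ} {s : ℝ} {E : Set (SpaceTime n)} {u v : HSpace n s}
    {φ : SpaceTime n → ℂ} (h : ((v : L2 n) : SpaceTime n → ℂ) =ᵐ[volume] fun z => φ z * (u : L2 n) z)
    (hu : u ∈ HSupp n s E) : v ∈ HSupp n s E := by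
  have hu : ∀ᵐ z : SpaceTime n, z ∉ E → (u : L2 n) z = 0 := hu
  change ∀ᵐ z : SpaceTime n, z ∉ E → (v : L2 n) z = 0
  filter_upwards [h, hu] with z h1 h2 hz
  rw [h1, h2 hz, mul_zero]

/-- For large `μ` the form becomes coercive on `𝓗ˢ_{closure Ω_T}` after conjugation by
`exp (μ t)`, whatever the size of the potential. -/
theorem exists_conjugation_coercive {n : ℕ} (hn : 1 ≤ n) {s : ℝ} (hs0 : 0 < s) (hs1 : s < 1) {T : ℝ}
    (hT : 0 < T) {Ω : Set (EuclideanSpace ℝ (Fin n))} (hΩ : IsOpen Ω) {Q : SpaceTime n → ℝ}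
    (hQ : MemLp Q ∞ (volume.restrict (cyl T Ω))) (lam : ℝ) :
    ∃ (α : ℝ) (M N : HSpace n s →L[ℂ] HSpace n s), 0 < α ∧
      (∀ v ∈ HSupp n s (closure (cyl T Ω)), M v ∈ HSupp n s (closure (cyl T Ω))) ∧
      (∀ v ∈ HSupp n s (closure (cyl T Ω)), N v ∈ HSupp n s (closure (cyl T Ω))) ∧
      (∀ v, M (N v) = v) ∧ (∀ v, N (M v) = v) ∧
      ∀ v ∈ HSupp n s (closure (cyl T Ω)),
        α * ‖v‖ ^ 2 ≤ (weakForm s T Ω Q lam (M v) (N v)).re := by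
  have hk := sector_pos hs0 hs1
  set q := ‖potential hΩ hQ lam‖ with hq
  have hq0 : 0 ≤ q := norm_nonneg _
  -- `μ ^ s / 3`, gained from the conjugation, pays for the `L²` part missing in the sector bound and
  -- for the potential.
  set μ : ℝ := (sector s + 3 * q) ^ (1 / s) with hμdef
  have hμ : 0 < μ := Real.rpow_pos_of_pos (by positivity) _
  have hμs : μ ^ s = sector s + 3 * q := by
    rw [hμdef, ← Real.rpow_mul (by positivity), one_div_mul_cancel hs0.ne', Real.rpow_one]
  obtain ⟨M, hM⟩ := exists_expMul_HSpace hn hs0 hs1 μ hT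
  obtain ⟨N, hN⟩ := exists_expMul_HSpace hn hs0 hs1 (-μ) hT
  refine ⟨sector s / 3, M, N, by positivity, fun v hv => mul_mem_HSupp (hM v) hv,
    fun v hv => mul_mem_HSupp (hN v) hv, fun v => ?_, fun v => ?_, fun v hv => ?_⟩
  · refine HSpace.incl_injective n s (Lp.ext ?_)
    filter_upwards [hM (N v), hN v] with z h1 h2
    have h5 : (expWeight (-μ) T z.fst : ℂ) * expWeight μ T z.fst = 1 := by
      exact_mod_cast expWeight_neg_mul μ T z.fst
    rw [h1, h2]
    linear_combination (v : L2 n) z * h5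
  · refine HSpace.incl_injective n s (Lp.ext ?_)
    filter_upwards [hN (M v), hM v] with z h1 h2
    have h5 : (expWeight (-μ) T z.fst : ℂ) * expWeight μ T z.fst = 1 := by
      exact_mod_cast expWeight_neg_mul μ T z.fst
    rw [h1, h2]
    linear_combination (v : L2 n) z * h5
  · have h1 := mainForm_exp_re_ge hn hs0 hs1 hμ (HSupp_time hv) (hM v) (hN v)
    have h2 := sector_mul_norm_sq_le hn hs0 hs1 v
    have h3 : inner ℂ (N v : L2 n) (potential hΩ hQ lam (M v : L2 n))
        = inner ℂ (v : L2 n) (potential hΩ hQ lam (v : L2 n)) := by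
      simp only [potential, sub_apply, smul_apply,
        inner_sub_right, inner_smul_right, inner_exp_mul μ T (hM v) (hN v)]
    have h4 : -(q * ‖(v : L2 n)‖ ^ 2)
        ≤ (inner ℂ (v : L2 n) (potential hΩ hQ lam (v : L2 n))).re := by
      refine (abs_le.1 ((Complex.abs_re_le_norm _).trans ?_)).1
      refine (norm_inner_le_norm _ _).trans ?_
      calc _ ≤ ‖(v : L2 n)‖ * (q * ‖(v : L2 n)‖) := by
            gcongr; exact (potential hΩ hQ lam).le_opNorm _
        _ = _ := by ring
    rw [weakForm_eq hs0 hΩ hQ, Complex.add_re, h3]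
    rw [hμs] at h1
    linarith

/-- Unique solvability, with a bound, for homogeneous exterior data. The uniqueness clause is the
absence of eigenvalues. -/
theorem weak_solvability {n : ℕ} (hn : 1 ≤ n) {s : ℝ} (hs0 : 0 < s) (hs1 : s < 1) {T : ℝ}
    (hT : 0 < T) {Ω : Set (EuclideanSpace ℝ (Fin n))} (hΩ : IsOpen Ω) {Q : SpaceTime n → ℝ}
    (hQ : MemLp Q ∞ (volume.restrict (cyl T Ω))) (lam : ℝ) :
    (∃ C : ℝ, 0 < C ∧ ∀ F : HDual n s T Ω, ∃ v : ↥(HSupp n s (closure (cyl T Ω))),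
      (∀ w : ↥(HSupp n s (closure (cyl T Ω))), weakForm s T Ω Q lam v w = F w) ∧
        ‖(v : HSpace n s)‖ ≤ C * ‖F‖) ∧
    ∀ v ∈ HSupp n s (closure (cyl T Ω)),
      (∀ w ∈ HSupp n s (closure (cyl T Ω)), weakForm s T Ω Q lam v w = 0) → v = 0 := by
  obtain ⟨α, M, N, hα, hM, hN, hMN, hNM, hco⟩ :=
    exists_conjugation_coercive hn hs0 hs1 hT hΩ hQ lam
  obtain ⟨A, hA⟩ := exists_weakForm_operator hs0 hΩ hQ lam
  have := completeSpace_HSpace n hs0.le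
  have : CompleteSpace ↥(HSupp n s (closure (cyl T Ω))) :=
    (isClosed_HSupp hs0.le isClosed_closure.measurableSet).completeSpace_coe
  constructor
  · obtain ⟨C, hC, h⟩ := exists_of_conjugate_coercive (HSupp n s (closure (cyl T Ω))) A M N hM hN
      hNM hα fun v hv => by rw [hA]; exact hco v hv
    refine ⟨C, hC, fun F => ?_⟩
    obtain ⟨v, hv, hvn⟩ := h F
    exact ⟨v, fun w => (hA _ _).symm.trans (hv w), hvn⟩
  · intro v hv h
    have h1 := hco (N v) (hN v hv)
    rw [hMN, h (N (N v)) (hN _ (hN v hv)), Complex.zero_re] at h1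
    have h2 : ‖N v‖ ^ 2 ≤ 0 := by
      by_contra hc
      nlinarith [mul_pos hα (not_le.1 hc)]
    have h3 : N v = 0 := by
      rw [← norm_eq_zero]; exact pow_eq_zero_iff (two_ne_zero) |>.1 (le_antisymm h2 (by positivity))
    rw [← hMN v, h3, map_zero]

/-! ### Well-posedness -/

theorem pairing_cyl_eq_zero {n : ℕ} {T : ℝ} {Ω : Set (EuclideanSpace ℝ (Fin n))} (hΩ : IsOpen Ω)
    {u w : SpaceTime n → ℂ} (hu : ∀ᵐ z : SpaceTime n, z.fst < T → u z = 0) :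
    pairing (cyl T Ω) u w = 0 := by
  refine integral_eq_zero_of_ae ?_
  filter_upwards [ae_restrict_of_ae hu, ae_restrict_mem (measurableSet_cyl T hΩ)] with z h1 h2
  simp [h1 h2.1.2]

theorem weakForm_eq_zero_of_causal {n : ℕ} (hn : 1 ≤ n) {s : ℝ} (hs0 : 0 < s) (hs1 : s < 1) {T : ℝ}
    {Ω : Set (EuclideanSpace ℝ (Fin n))} (hΩ : IsOpen Ω) {Q : SpaceTime n → ℝ} (lam : ℝ)
    {u w : HSpace n s} (hu : ∀ᵐ z : SpaceTime n, z.fst < T → (u : L2 n) z = 0)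
    (hw : w ∈ HSupp n s (closure (cyl T Ω))) : weakForm s T Ω Q lam u w = 0 := by
  rw [weakForm, BForm, pairing_fracHeat hs0,
    mainForm_eq_zero_of_causal hn hs0 hs1 u w hu, pairing_cyl_eq_zero hΩ hu,
    pairing_cyl_eq_zero hΩ]
  · simp
  · filter_upwards [hu] with z hz h
    rw [hz h, mul_zero]
  · filter_upwards [HSupp_time hw] with z hz h
    exact hz fun h' => absurd h'.2 (not_le.2 h)

theorem weakForm_sub {n : ℕ} {s : ℝ} (hs0 : 0 < s) {T : ℝ}
    {Ω : Set (EuclideanSpace ℝ (Fin n))} (hΩ : IsOpen Ω) {Q : SpaceTime n → ℝ}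
    (hQ : MemLp Q ∞ (volume.restrict (cyl T Ω))) (lam : ℝ) (u v w : HSpace n s) :
    weakForm s T Ω Q lam (u - v) w = weakForm s T Ω Q lam u w - weakForm s T Ω Q lam v w := by
  obtain ⟨A, hA⟩ := exists_weakForm_operator hs0 hΩ hQ lam
  rw [← hA, ← hA, ← hA, map_sub, inner_sub_right]

theorem timeCut_of_mem {n : ℕ} {T : ℝ} (u : SpaceTime n → ℂ) {z : SpaceTime n}
    (hz : z.fst ∈ Icc (-T) T) : timeCut T u z = u z :=
  indicator_of_mem (show z ∈ {z : SpaceTime n | z.fst ∈ Icc (-T) T} from hz) _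

theorem timeCut_of_notMem {n : ℕ} {T : ℝ} (u : SpaceTime n → ℂ) {z : SpaceTime n}
    (hz : z.fst ∉ Icc (-T) T) : timeCut T u z = 0 :=
  indicator_of_notMem (show z ∉ {z : SpaceTime n | z.fst ∈ Icc (-T) T} from hz) _

theorem ae_of_extends {n : ℕ} {s T : ℝ} {Ω : Set (EuclideanSpace ℝ (Fin n))} {g : HSpace n s}
    {f : Lp ℂ 2 (volume.restrict (extCyl T Ω))} (hg : Extends g f) :
    ∀ᵐ z : SpaceTime n, z ∈ extCyl T Ω → (g : L2 n) z = f z :=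
  (ae_restrict_iff' (measurableSet_cyl T isClosed_closure.isOpen_compl)).1 hg

/-- The difference of two cut-off solutions is supported in the closed cylinder, where the homogeneous
problem has only the zero solution. -/
theorem cutSolution_unique {n : ℕ} (hn : 1 ≤ n) {s : ℝ} (hs0 : 0 < s) (hs1 : s < 1) {T : ℝ}
    (hT : 0 < T) {Ω : Set (EuclideanSpace ℝ (Fin n))} (hΩ : IsOpen Ω) {Q : SpaceTime n → ℝ}
    (hQ : MemLp Q ∞ (volume.restrict (cyl T Ω))) (lam : ℝ) {F : HDual n s T Ω}
    {f : HRestr n s (extCyl T Ω)} {U₁ U₂ : HSpace n s} (h₁ : IsCutSolution s T Ω Q lam F f U₁)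
    (h₂ : IsCutSolution s T Ω Q lam F f U₂) : U₁ = U₂ := by
  obtain ⟨g₁, hg₁, v₁, hv₁, he₁⟩ := h₁.exterior
  obtain ⟨g₂, hg₂, v₂, hv₂, he₂⟩ := h₂.exterior
  have hv₁ : ∀ᵐ z : SpaceTime n, z ∉ closure (cyl T Ω) → (v₁ : L2 n) z = 0 := hv₁
  have hv₂ : ∀ᵐ z : SpaceTime n, z ∉ closure (cyl T Ω) → (v₂ : L2 n) z = 0 := hv₂
  rw [← sub_eq_zero]
  refine (weak_solvability hn hs0 hs1 hT hΩ hQ lam).2 _ ?_ fun w hw => ?_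
  · change ∀ᵐ z : SpaceTime n, z ∉ closure (cyl T Ω) → ((U₁ - U₂ : HSpace n s) : L2 n) z = 0
    rw [map_sub]
    filter_upwards [Lp.coeFn_sub (U₁ : L2 n) (U₂ : L2 n), h₁.cut, h₂.cut, hv₁, hv₂, he₁, he₂,
      ae_of_extends hg₁, ae_of_extends hg₂, ae_fst_ne (n := n) T, ae_fst_ne (n := n) (-T)]
      with z h0 c1 c2 z1 z2 e1 e2 x1 x2 hT1 hT2 hz
    rw [h0, Pi.sub_apply]
    by_cases ht : z.fst ∈ Icc (-T) T
    · have ht' : z.fst ∈ Ioo (-T) T := ⟨lt_of_le_of_ne ht.1 hT2.symm, lt_of_le_of_ne ht.2 hT1⟩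
      have hx : z ∈ extCyl T Ω := ⟨ht', fun h => hz (mem_closure_cyl ht' h)⟩
      rw [z1 hz, timeCut_of_mem _ ht, Pi.sub_apply, x1 hx] at e1
      rw [z2 hz, timeCut_of_mem _ ht, Pi.sub_apply, x2 hx] at e2
      linear_combination e2 - e1
    · rw [c1, c2, timeCut_of_notMem _ ht, timeCut_of_notMem _ ht, sub_zero]
  · rw [weakForm_sub hs0 hΩ hQ]
    exact sub_eq_zero.2 ((h₁.equation ⟨w, hw⟩).trans (h₂.equation ⟨w, hw⟩).symm)

/-- Solutions for a fixed extension `g` of the exterior datum. -/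
theorem exists_cutSolution {n : ℕ} (hn : 1 ≤ n) {s : ℝ} (hs0 : 0 < s) (hs1 : s < 1) {T : ℝ}
    (hT : 0 < T) {Ω : Set (EuclideanSpace ℝ (Fin n))} (hΩ : IsOpen Ω) {Q : SpaceTime n → ℝ}
    (hQ : MemLp Q ∞ (volume.restrict (cyl T Ω))) (lam : ℝ) :
    ∃ C : ℝ, 0 < C ∧ ∀ (F : HDual n s T Ω) (f : HRestr n s (extCyl T Ω)) (g : HSpace n s),
      Extends g f.1 → ∃ U : HSpace n s, IsCutSolution s T Ω Q lam F f U ∧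
        IsWeakSolution s T Ω Q lam F f U ∧ ‖U‖ ≤ C * (‖F‖ + ‖g‖) := by
  obtain ⟨⟨C, hC, hsol⟩, -⟩ := weak_solvability hn hs0 hs1 hT hΩ hQ lam
  obtain ⟨A, hA⟩ := exists_weakForm_operator hs0 hΩ hQ lam
  obtain ⟨M, hM⟩ := exists_timeCut_HSpace (n := n) hn hs0 hs1 T
  set V := HSupp n s (closure (cyl T Ω)) with hV
  refine ⟨C + (C * ‖A‖ + 1) * ‖M‖, by positivity, fun F f g hg => ?_⟩
  let G : HDual n s T Ω := (innerSLFlip ℂ (A (M g))).comp V.subtypeL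
  have hG : ∀ w : V, G w = weakForm s T Ω Q lam (M g) w := fun w => hA _ _
  have hGn : ‖G‖ ≤ ‖A‖ * (‖M‖ * ‖g‖) := by
    refine ContinuousLinearMap.opNorm_le_bound _ (by positivity) fun w => ?_
    have h1 : ‖G w‖ ≤ ‖(w : HSpace n s)‖ * ‖A (M g)‖ :=
      norm_inner_le_norm (𝕜 := ℂ) (w : HSpace n s) (A (M g))
    calc ‖G w‖ ≤ ‖(w : HSpace n s)‖ * ‖A (M g)‖ := h1
      _ ≤ ‖(w : HSpace n s)‖ * (‖A‖ * (‖M‖ * ‖g‖)) := by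
          gcongr
          exact (A.le_opNorm _).trans (by gcongr; exact M.le_opNorm _)
      _ = ‖A‖ * (‖M‖ * ‖g‖) * ‖w‖ := by rw [mul_comm]; rfl
  obtain ⟨v, hv, hvn⟩ := hsol (F - G)
  have hvs : ∀ᵐ z : SpaceTime n, z ∉ closure (cyl T Ω) → ((v : HSpace n s) : L2 n) z = 0 := v.2
  have hU : (((v : HSpace n s) + M g : HSpace n s) : L2 n) =ᵐ[volume]
      fun z => ((v : HSpace n s) : L2 n) z + timeCut T (g : L2 n) z := by
    rw [map_add]
    filter_upwards [Lp.coeFn_add ((v : HSpace n s) : L2 n) (M g : L2 n), hM g] with z h1 h2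
    rw [h1, Pi.add_apply, h2]
  have heq : WeakEq s T Ω Q lam F ((v : HSpace n s) + M g) := by
    intro w
    have h1 := weakForm_sub hs0 hΩ hQ lam ((v : HSpace n s) + M g) (M g) w
    rw [add_sub_cancel_right, hv w, ← hG, sub_apply] at h1
    exact (sub_left_inj.1 h1).symm
  refine ⟨v + M g, ⟨?_, ⟨g, hg, v, v.2, ?_⟩, heq⟩, ⟨?_, ?_, heq⟩, ?_⟩
  · filter_upwards [hU, HSupp_time v.2] with z h1 h2
    by_cases ht : z.fst ∈ Icc (-T) T
    · rw [timeCut_of_mem _ ht]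
    · rw [timeCut_of_notMem _ ht, h1, h2 ht, timeCut_of_notMem _ ht, add_zero]
  · filter_upwards [hU, HSupp_time v.2] with z h1 h2
    by_cases ht : z.fst ∈ Icc (-T) T
    · rw [timeCut_of_mem _ ht, Pi.sub_apply, h1, timeCut_of_mem _ ht, add_sub_cancel_right]
    · rw [timeCut_of_notMem _ ht, h2 ht]
  · refine (ae_restrict_iff' (measurableSet_cyl T isClosed_closure.isOpen_compl)).2 ?_
    filter_upwards [hU, hvs, ae_of_extends hg] with z h1 h2 h3 hz
    have hz' : z ∉ closure (cyl T Ω) := fun h => hz.2 (closure_cyl_subset h).2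
    rw [h1, h2 hz', timeCut_of_mem _ (Ioo_subset_Icc_self hz.1), h3 hz, zero_add]
  · filter_upwards [hU, HSupp_time v.2, ae_fst_ne (n := n) (-T)] with z h1 h2 h3 hz
    have ht : z.fst ∉ Icc (-T) T := fun h => h3 (le_antisymm hz h.1)
    rw [h1, h2 ht, timeCut_of_notMem _ ht, add_zero]
  · calc ‖(v : HSpace n s) + M g‖ ≤ ‖(v : HSpace n s)‖ + ‖M g‖ := norm_add_le _ _
      _ ≤ C * (‖F‖ + ‖A‖ * (‖M‖ * ‖g‖)) + ‖M‖ * ‖g‖ := by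
          gcongr
          · have h1 : ‖F - G‖ ≤ ‖F‖ + ‖G‖ := norm_sub_le F G
            exact hvn.trans (by gcongr; linarith)
          · exact M.le_opNorm _
      _ ≤ (C + (C * ‖A‖ + 1) * ‖M‖) * (‖F‖ + ‖g‖) := by
          have h1 : 0 ≤ (C * ‖A‖ + 1) * ‖M‖ * ‖F‖ := by positivity
          have h2 : 0 ≤ C * ‖g‖ := by positivity
          linarith

/-- The cut-off of a weak solution is a cut-off solution: by causality, what is removed does not enter
the equation in `Ω_T`. -/
theorem cutSolution_of_weakSolution {n : ℕ} (hn : 1 ≤ n) {s : ℝ} (hs0 : 0 < s) (hs1 : s < 1) {T : ℝ}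
    {Ω : Set (EuclideanSpace ℝ (Fin n))} (hΩ : IsOpen Ω) {Q : SpaceTime n → ℝ}
    (hQ : MemLp Q ∞ (volume.restrict (cyl T Ω))) (lam : ℝ) {F : HDual n s T Ω}
    {f : HRestr n s (extCyl T Ω)} {u : HSpace n s} (hu : IsWeakSolution s T Ω Q lam F f u) :
    ∃ U : HSpace n s, IsCutSolution s T Ω Q lam F f U ∧
      ∀ᵐ z : SpaceTime n, z.fst ≤ T → (u : L2 n) z = (U : L2 n) z := by
  obtain ⟨M, hM⟩ := exists_timeCut_HSpace (n := n) hn hs0 hs1 T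
  have hle : ∀ᵐ z : SpaceTime n, z.fst ≤ T → (u : L2 n) z = (M u : L2 n) z := by
    filter_upwards [hM u, hu.initial] with z h1 h2 h3
    by_cases ht : z.fst ∈ Icc (-T) T
    · rw [h1, timeCut_of_mem _ ht]
    · rw [h1, timeCut_of_notMem _ ht]
      exact h2 (le_of_not_ge fun h => ht ⟨h, h3⟩)
  refine ⟨M u, ⟨?_, ⟨u, hu.exterior, 0, Submodule.zero_mem _, ?_⟩, fun w => ?_⟩, hle⟩
  · filter_upwards [hM u] with z h1
    by_cases ht : z.fst ∈ Icc (-T) T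
    · rw [timeCut_of_mem _ ht]
    · rw [timeCut_of_notMem _ ht, h1, timeCut_of_notMem _ ht]
  · rw [map_zero]
    filter_upwards [hM u, Lp.coeFn_zero ℂ 2 (volume : Measure (SpaceTime n))] with z h1 h2
    by_cases ht : z.fst ∈ Icc (-T) T
    · rw [h2, timeCut_of_mem _ ht, Pi.sub_apply, h1, timeCut_of_mem _ ht, sub_self, Pi.zero_apply]
    · rw [h2, timeCut_of_notMem _ ht, Pi.zero_apply]
  · have h1 : weakForm s T Ω Q lam (u - M u) w = 0 := by
      refine weakForm_eq_zero_of_causal hn hs0 hs1 hΩ lam ?_ w.2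
      rw [map_sub]
      filter_upwards [hle, Lp.coeFn_sub (u : L2 n) (M u : L2 n)] with z h2 h3 h4
      rw [h3, Pi.sub_apply, h2 h4.le, sub_self]
    rw [weakForm_sub hs0 hΩ hQ, sub_eq_zero] at h1
    exact h1.symm.trans (hu.equation w)

/-- The problem is well-posed at every `lam`. -/
theorem wellPosed {n : ℕ} (hn : 1 ≤ n) {s : ℝ} (hs0 : 0 < s) (hs1 : s < 1) {T : ℝ}
    (hT : 0 < T) {Ω : Set (EuclideanSpace ℝ (Fin n))} (hΩ : IsOpen Ω) {Q : SpaceTime n → ℝ}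
    (hQ : MemLp Q ∞ (volume.restrict (cyl T Ω))) (lam : ℝ) : WellPosed s T Ω Q lam := by
  obtain ⟨C, hC, hsol⟩ := exists_cutSolution hn hs0 hs1 hT hΩ hQ lam
  refine ⟨C, hC, fun F f => ?_⟩
  obtain ⟨g₀, hg₀⟩ := f.2
  obtain ⟨U, hcut, hweak, -⟩ := hsol F f g₀ hg₀
  refine ⟨U, hcut, fun U' hU' => cutSolution_unique hn hs0 hs1 hT hΩ hQ lam hU' hcut, hweak,
    fun u hu => ?_, ?_⟩
  · obtain ⟨U', hU', hle⟩ := cutSolution_of_weakSolution hn hs0 hs1 hΩ hQ lam hu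
    rwa [cutSolution_unique hn hs0 hs1 hT hΩ hQ lam hU' hcut] at hle
  · have h : ‖U‖ / C - ‖F‖ ≤ f.norm := by
      refine le_csInf ⟨‖g₀‖, g₀, hg₀, rfl⟩ ?_
      rintro r ⟨g, hg, rfl⟩
      obtain ⟨U', hcut', -, hn'⟩ := hsol F f g hg
      rw [cutSolution_unique hn hs0 hs1 hT hΩ hQ lam hcut' hcut] at hn'
      rw [sub_le_iff_le_add, div_le_iff₀ hC]
      linarith
    rw [sub_le_iff_le_add, div_le_iff₀ hC] at h
    linarith

/-- The eigenvalue condition is uniqueness of the weak solution with zero data. -/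
theorem eigenvalueCondition {n : ℕ} (hn : 1 ≤ n) {s : ℝ} (hs0 : 0 < s) (hs1 : s < 1) {T : ℝ}
    (hT : 0 < T) {Ω : Set (EuclideanSpace ℝ (Fin n))} (hΩ : IsOpen Ω) {Q : SpaceTime n → ℝ}
    (hQ : MemLp Q ∞ (volume.restrict (cyl T Ω))) : EigenvalueCondition s T Ω Q := by
  intro u heq hext hinit
  have hzero : Extends (0 : HSpace n s) (0 : Lp ℂ 2 (volume.restrict (extCyl T Ω))) := by
    have h0 : ((0 : L2 n) : SpaceTime n → ℂ) =ᵐ[volume.restrict (extCyl T Ω)] 0 :=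
      ae_restrict_of_ae (Lp.coeFn_zero ℂ 2 volume)
    rw [Extends, map_zero]
    exact h0.trans (Lp.coeFn_zero ℂ 2 (volume.restrict (extCyl T Ω))).symm
  obtain ⟨C, -, h⟩ := wellPosed hn hs0 hs1 hT hΩ hQ 0
  obtain ⟨U, -, -, -, huniq, hnorm⟩ := h 0 ⟨0, 0, hzero⟩
  have hsol : ∀ u : HSpace n s,
      (∀ w ∈ HSupp n s (closure (cyl T Ω)), BForm s T Ω Q u w = 0) →
      (∀ᵐ z : SpaceTime n, z ∈ extCyl T Ω → (u : L2 n) z = 0) →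
      (∀ᵐ z : SpaceTime n, z.fst ≤ -T → (u : L2 n) z = 0) →
      IsWeakSolution s T Ω Q 0 0 ⟨0, 0, hzero⟩ u := by
    intro u heq hext hinit
    refine ⟨?_, hinit, fun w => ?_⟩
    · have h1 : ((u : L2 n) : SpaceTime n → ℂ) =ᵐ[volume.restrict (extCyl T Ω)] 0 :=
        (ae_restrict_iff' (measurableSet_cyl T isClosed_closure.isOpen_compl)).2 hext
      exact h1.trans (Lp.coeFn_zero ℂ 2 (volume.restrict (extCyl T Ω))).symm
    · rw [heq w w.2]; simp
  have h0 : ∀ᵐ z : SpaceTime n, ((0 : HSpace n s) : L2 n) z = 0 := by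
    rw [map_zero]; exact Lp.coeFn_zero ℂ 2 volume
  have hz := hsol 0 (fun w hw => ?_) (h0.mono fun _ h _ => h) (h0.mono fun _ h _ => h)
  · filter_upwards [huniq u (hsol u heq hext hinit), huniq 0 hz, h0] with z h1 h2 h3 h4
    rw [h1 h4.le, ← h2 h4.le, h3]
  · have h5 := weakForm_sub hs0 hΩ hQ 0 0 0 w
    rw [sub_self, sub_self] at h5
    simpa [weakForm] using h5

end FracHeat

end

open FracHeat in
theorem theorem3p1 (n : ℕ) (hn : 1 ≤ n) (s : ℝ) (hs0 : 0 < s) (hs1 : s < 1) (T : ℝ) (hT : 0 < T)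
    (Ω : Set (EuclideanSpace ℝ (Fin n))) (hΩo : IsOpen Ω) (hΩb : Bornology.IsBounded Ω)
    (Q : SpaceTime n → ℝ) (hQ : MemLp Q ∞ (volume.restrict (cyl T Ω))) :
    (∃ ev : ℕ → ℝ, Monotone ev ∧ Tendsto ev atTop atTop ∧
      (∀ lam : ℝ, lam ∉ range ev → WellPosed s T Ω Q lam) ∧
      (EigenvalueCondition s T Ω Q ↔ (0 : ℝ) ∉ range ev) ∧
      ((∀ᵐ z ∂(volume.restrict (cyl T Ω)), 0 ≤ Q z) →
        range ev ⊆ Ioi 0 ∧ EigenvalueCondition s T Ω Q)) ∧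
    (∀ lam : ℝ, EigenvalueCondition s T Ω (fun z => Q z - lam) ↔ WellPosed s T Ω Q lam) := by
  have hEC := eigenvalueCondition hn hs0 hs1 hT hΩo hQ
  have hpos : ∀ k : ℕ, (0 : ℝ) < (k : ℝ) + 1 := fun k => by positivity
  -- No `lam` is exceptional, so that the sequence only has to be positive, monotone and unbounded.
  refine ⟨⟨fun k => (k : ℝ) + 1, fun k l h => by simpa using h, ?_,
    fun lam _ => wellPosed hn hs0 hs1 hT hΩo hQ lam, ⟨fun _ => ?_, fun _ => hEC⟩,
    fun _ => ⟨?_, hEC⟩⟩, fun lam => ⟨fun _ => wellPosed hn hs0 hs1 hT hΩo hQ lam, fun _ => ?_⟩⟩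
  · exact tendsto_atTop_add_const_right _ _ tendsto_natCast_atTop_atTop
  · rintro ⟨k, hk⟩
    exact (hpos k).ne' hk
  · rintro _ ⟨k, rfl⟩
    exact hpos k
  · exact eigenvalueCondition hn hs0 hs1 hT hΩo (hQ.sub (memLp_top_const lam))
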